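/- **Setting.** Fix $k\ge 1$. Let $(F_n)_{n\ge0}$ and $(C_n)_{n\ge1}$ be finite subsets of $\mathbb Z\times\{1,\dots,k\}$ and $\{1,\dots,k\}\times\mathbb Z\times\{1,\dots,k\}$ respectively. Put $(f,i)*(i,c,j)=(f+c,j)$ (products with non-matching indices are undefined), $F_n^i=F_n\cap(\mathbb Z\times\{i\})$ and $C_n^{i,j}=C_n\cap(\{i\}\times\mathbb Z\times\{j\})$. Assume that $F_0=\{0\}\times\{1,\dots,k\}$; $\sum_j\#C_n^{i,j}>1$ for all $i$ and $n\ge1$; $F_n^i=\{0,1,\dots,\#F_n^i-1\}\times\{i\}\ne\emptyset$; $F_n*C_{n+1}\subset F_{n+1}$; and $F_n*\boldsymbol c\cap F_n*\boldsymbol c'=\emptyset$ for distinct $\boldsymbol c,\boldsymbol c'\in C_{n+1}$. Let $X_n$ be the compact space of sequences $(f_n,c_{n+1},c_{n+2},\dots)\in F_n\times C_{n+1}\times C_{n+2}\times\cdots$ for which all products $f_n*c_{n+1}*\cdots*c_l$ are defined, and let $X$ be the topological inductive limit of the $X_n$ under the embeddings $(f_n,c_{n+1},c_{n+2},\dots)\mapsto(f_n*c_{n+1},c_{n+2},\dots)$.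 For $A\subset F_n$ let $[A]_n\subset X$ be the set of points of $X_n$ with $f_n\in A$; thus $X_0=[F_0]_0$. For $g\in\mathbb Z$ put $T_g(f_n,c_{n+1},\dots)=(g+f_n,c_{n+1},\dots)$ (adding $g$ to the integer part of $f_n$) whenever $g+f_n\in F_n$; this defines a $\mathbb Z$-action, the $(C,F)$-action, on the set $X^{\mathbb Z}$ of those $x\in X$ for which, for every $g$, this applies for some $n$. A $(C,F)$-measure is a Borel measure $\mu$ on $X$ with $\mu([A]_n)=\sum_i\#(A\cap F_n^i)\,\lambda_n^i$ for all $n$ and $A\subset F_n$, for some nonnegative reals $\lambda_n^i$. Two measure preserving transformations are called isomorphic here if they are isomorphic modulo null sets and up to multiplying the measure by a positive constant. An invertible measure preserving transformation $T$ is *of balanced finite rank* if it is isomorphic to (the generator $T_1$ of) a $(C,F)$-action as above, with a $(C,F)$-measure $\mu$, such that $\mu(X\setminus X^{\mathbb Z})=0$ and * $\mu(X_0)=1$; * the limits $\delta_j=\lim_{n}\mu(X_0\cap[F_n^j]_n)$ exist and are positive, and $\sum_j\delta_j=1$; * there are $\Lambda_1,\dots,\Lambda_k>0$ with $\sum_i\Lambda_i=1$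 and $\displaystyle\lim_{n}\frac{\lambda_n^i}{\sum_l\lambda_n^l}=\lim_{n}\frac{\#C_n^{i,j}}{\sum_l\#C_n^{l,j}}=\Lambda_i$ for all $i,j$. Such a $(C,F)$-action with $\mu$ is called a *balanced model* of $T$. **Theorem 5.5.** Let $T$ be an ergodic invertible measure preserving transformation of balanced finite rank of a standard $\sigma$-finite measure space $(\Omega,m)$ with $m(\Omega)=\infty$. 1. For every balanced model of $T$, with $h_l:=\min_{1\le i\le k}\#F_l^i$, we have $h_l\to\infty$, and for all Borel sets $A,B\subset X_0$ $$\lim_{l\to\infty}\frac{\sum_{j=0}^{h_l-1}\mu(A\cap T_jB)}{\sum_{j=0}^{h_l-1}\mu(X_0\cap T_jX_0)}=\mu(A)\mu(B).$$ 2. $T$ is subsequence weakly rationally ergodic: there are a measurable set $Y$ with $0<m(Y)<\infty$ and integers $h_1<h_2<\cdots$ such that, with $a_n:=\sum_{j=0}^{h_n-1}m(Y\cap T^jY)/m(Y)^2$, $$\lim_{n\to\infty}\frac1{a_n}\sum_{j=0}^{h_n-1}m(A\cap T^jB)=m(A)m(B)\quad\text{for all measurable }A,B\subset Y.$$ 3.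 $T$ is non-squashable: every measurable $Q:\Omega\to\Omega$ with $m(Q^{-1}A)=0\iff m(A)=0$ for all measurable $A$, and with $QT=TQ$ almost everywhere, preserves $m$. -/

import Mathlib

open MeasureTheory Filter Topology
open scoped ENNReal NNReal

/-! ### Combinatorial data of a cutting-and-stacking construction with `k` towers over `ℤ` -/

/-- Data `(C_n, F_{n-1})_{n ≥ 1}` of the (C,F)-construction of a `ℤ`-action of rank at most `k`.
An element `(f, i)` of `F n` is the level number `f` of the `i`-th tower of the `n`-th castle;
an element `(i, c, j)` of `C n` says that a copy of the `i`-th tower of the `(n-1)`-st castle is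
placed inside the `j`-th tower of the `n`-th castle, with its base at level `c`.
Only the sets `C n` with `1 ≤ n` are used. -/
structure CFData (k : ℕ) where
  F : ℕ → Finset (ℤ × Fin k)
  C : ℕ → Finset (Fin k × ℤ × Fin k)
  /-- `F_0 = {0} × {1, …, k}` -/
  mem_F_zero : ∀ f : ℤ × Fin k, f ∈ F 0 ↔ f.1 = 0
  /-- `∑_j #C_n^{i,j} > 1` for all `n ≥ 1` and all `i` -/
  one_lt_card_C : ∀ (n : ℕ) (i : Fin k), 1 < ((C (n + 1)).filter fun c => c.1 = i).card
  /-- the base level belongs to every tower -/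
  zero_mem_F : ∀ (n : ℕ) (i : Fin k), ((0 : ℤ), i) ∈ F n
  /-- `F_n * C_{n+1} ⊆ F_{n+1}` -/
  mul_mem_F : ∀ (n : ℕ), ∀ f ∈ F n, ∀ c ∈ C (n + 1), f.2 = c.1 →
    (f.1 + c.2.1, c.2.2) ∈ F (n + 1)
  /-- `F_n * c` and `F_n * c'` are disjoint for distinct `c, c' ∈ C_{n+1}` -/
  mul_disjoint : ∀ (n : ℕ), ∀ c ∈ C (n + 1), ∀ c' ∈ C (n + 1), c ≠ c' →
    ∀ f ∈ F n, ∀ f' ∈ F n, f.2 = c.1 → f'.2 = c'.1 →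
      (f.1 + c.2.1, c.2.2) ≠ (f'.1 + c'.2.1, c'.2.2)
  /-- finite rank, and not merely finite funny rank: `F_n^i = {0, 1, …, #F_n^i - 1}` -/
  interval : ∀ (n : ℕ) (i : Fin k) (f : ℤ),
    (f, i) ∈ F n ↔ 0 ≤ f ∧ f < (((F n).filter fun a => a.2 = i).card : ℤ)

namespace CFData

variable {k : ℕ} (D : CFData k)

/-- `#F_n^i`, the height of the `i`-th tower of the `n`-th castle. -/
def height (n : ℕ) (i : Fin k) : ℕ := ((D.F n).filter fun a => a.2 = i).card

/-- `h_n = min_i #F_n^i`. -/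
noncomputable def minHeight (n : ℕ) : ℕ := ⨅ i : Fin k, D.height n i

/-- `r_n^{i,j} = #C_n^{i,j}`. -/
def copies (n : ℕ) (i j : Fin k) : ℕ := ((D.C n).filter fun c => c.1 = i ∧ c.2.2 = j).card

/-! ### The (C,F)-space -/

/-- The compact space `X_n` of all sequences `(f_n, c_{n+1}, c_{n+2}, …)` in
`F_n × C_{n+1} × C_{n+2} × ⋯` for which all products `f_n * c_{n+1} * ⋯ * c_l` are defined.
The entry `x.2 m` is `c_{n+1+m}`. -/
def Path (n : ℕ) : Type :=
  {x : (ℤ × Fin k) × (ℕ → Fin k × ℤ × Fin k) //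
    x.1 ∈ D.F n ∧ (∀ m, x.2 m ∈ D.C (n + 1 + m)) ∧
      x.1.2 = (x.2 0).1 ∧ ∀ m, (x.2 m).2.2 = (x.2 (m + 1)).1}

/-- The product topology (of the discrete topologies), restricted to `X_n`. -/
instance (n : ℕ) : TopologicalSpace (D.Path n) := instTopologicalSpaceSubtype

variable {D}

/-- The first coordinate `f_n` of a point of `X_n`. -/
def Path.head {n : ℕ} (p : D.Path n) : ℤ × Fin k := p.1.1

/-- The embedding `(f_n, c_{n+1}, c_{n+2}, …) ↦ (f_n * c_{n+1}, c_{n+2}, …)` of `X_n` into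
`X_{n+1}`. -/
def Path.embed {n : ℕ} (p : D.Path n) : D.Path (n + 1) :=
  ⟨((p.1.1.1 + (p.1.2 0).2.1, (p.1.2 0).2.2), fun m => p.1.2 (m + 1)),
    D.mul_mem_F n _ p.2.1 _ (p.2.2.1 0) p.2.2.2.1,
    fun m => by
      have h := p.2.2.1 (m + 1)
      rwa [show n + 1 + (m + 1) = n + 1 + 1 + m by omega] at h,
    p.2.2.2.2 0, fun m => p.2.2.2.2 (m + 1)⟩

/-- `(g · f_n, c_{n+1}, c_{n+2}, …)`, provided that `g · f_n ∈ F_n`. -/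
def Path.translate {n : ℕ} (g : ℤ) (p : D.Path n) (h : (g + p.head.1, p.head.2) ∈ D.F n) :
    D.Path n :=
  ⟨((g + p.head.1, p.head.2), p.1.2), h, p.2.2.1, p.2.2.2.1, p.2.2.2.2⟩

variable (D)

/-- The (C,F)-space: the topological inductive limit of `X_0 ⊆ X_1 ⊆ X_2 ⊆ ⋯`, that is, the
disjoint union of the `X_n` with each point identified with its image in the next space. -/
def Space : Type :=
  Quot fun a b : (n : ℕ) × D.Path n => b = ⟨a.1 + 1, a.2.embed⟩

instance : TopologicalSpace D.Space := instTopologicalSpaceQuot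

instance : MeasurableSpace D.Space := borel D.Space

instance : BorelSpace D.Space := ⟨rfl⟩

variable {D} in
/-- The point of the (C,F)-space that is given by a point of `X_n`. -/
def Path.pt {n : ℕ} (p : D.Path n) : D.Space := Quot.mk _ ⟨n, p⟩

/-- The `n`-cylinder `[A]_n` of all `(f_n, c_{n+1}, …)` in `X_n` with `f_n ∈ A`. -/
def cyl (n : ℕ) (A : Set (ℤ × Fin k)) : Set D.Space :=
  {x | ∃ p : D.Path n, p.head ∈ A ∧ p.pt = x}

/-- `X_0 = [F_0]_0`, as a subset of the (C,F)-space. -/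
def base : Set D.Space := D.cyl 0 {f | f ∈ D.F 0}

/-! ### The (C,F)-action -/

/-- The set `X^g` of all points that have, for some `n`, a representative in `X_n` with
`g · f_n ∈ F_n`. -/
def translatable (g : ℤ) : Set D.Space :=
  {x | ∃ (n : ℕ) (p : D.Path n), p.pt = x ∧ (g + p.head.1, p.head.2) ∈ D.F n}

/-- The set `⋂_g X^g`, on which the action lives. -/
def domain : Set D.Space := ⋂ g : ℤ, D.translatable g

open Classical in
/-- The (C,F)-action `T_g (f_n, c_{n+1}, …) = (g · f_n, c_{n+1}, …)` on `⋂_g X^g`. The result does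
not depend on the representative (see `act_pt`). Outside `⋂_g X^g`, which will be a null
set, `T_g` is put equal to the identity. -/
noncomputable def act (g : ℤ) (x : D.Space) : D.Space :=
  if h : x ∈ D.domain then
    (Path.translate g (Set.mem_iInter.1 h g).choose_spec.choose
      (Set.mem_iInter.1 h g).choose_spec.choose_spec.2).pt
  else x

variable {D} in
/-- The action does not depend on the representative. -/
theorem act_pt {g : ℤ} {n : ℕ} (p : D.Path n) (hp : p.pt ∈ D.domain)
    (h : (g + p.head.1, p.head.2) ∈ D.F n) : D.act g p.pt = (p.translate g h).pt := by
  set r : ((n : ℕ) × D.Path n) → ((n : ℕ) × D.Path n) → Prop :=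
    fun a b => b = ⟨a.1 + 1, a.2.embed⟩ with hr
  have key : ∀ a b, Relation.ReflTransGen r a b →
      ∀ ha : (g + a.2.head.1, a.2.head.2) ∈ D.F a.1,
      ∃ hb : (g + b.2.head.1, b.2.head.2) ∈ D.F b.1,
        (a.2.translate g ha).pt = (b.2.translate g hb).pt := by
    intro a b hab ha
    induction hab with
    | refl => exact ⟨ha, rfl⟩
    | @tail b c _ hbc ih =>
      obtain ⟨hb, e⟩ := ih
      have hbc' : c = ⟨b.1 + 1, b.2.embed⟩ := hbc
      subst hbc'
      obtain ⟨n, q⟩ := b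
      have h1 : (q.translate g hb).embed.head = (g + q.embed.head.1, q.embed.head.2) := by
        simp [Path.translate, Path.embed, Path.head, add_assoc]
      have hc : (g + q.embed.head.1, q.embed.head.2) ∈ D.F (n + 1) := by
        rw [← h1]; exact (q.translate g hb).embed.2.1
      refine ⟨hc, e.trans ?_⟩
      have h2 : (q.translate g hb).embed = q.embed.translate g hc :=
        Subtype.ext (Prod.ext h1 rfl)
      have h3 : (q.translate g hb).pt = (q.translate g hb).embed.pt := Quot.sound rfl
      rw [h3, h2]
  unfold act
  rw [dif_pos hp]
  generalize_proofs h1 h2 h3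
  have e := h2.choose_spec.1
  set q := h2.choose with hq
  have e' : Quot.mk r ⟨h1.choose, q⟩ = Quot.mk r ⟨n, p⟩ := e
  have hj : Relation.Join (Relation.ReflTransGen r) ⟨h1.choose, q⟩ ⟨n, p⟩ := by
    have hE := Quot.eqvGen_exact e'
    have hchurch : ∀ a b c, r a b → r a c →
        ∃ d, Relation.ReflGen r b d ∧ Relation.ReflTransGen r c d := by
      intro a b c hab hac
      have : b = c := Eq.trans hab (Eq.symm hac)
      exact ⟨b, .refl, this ▸ .refl⟩
    have heq := Relation.equivalence_join_reflTransGen hchurch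
    refine heq.eqvGen_iff.1 (hE.mono fun a b hab => ?_)
    exact ⟨b, .single hab, .refl⟩
  obtain ⟨c, hc1, hc2⟩ := hj
  obtain ⟨_, e1⟩ := key _ _ hc1 h3
  obtain ⟨_, e2⟩ := key _ _ hc2 h
  exact e1.trans e2.symm

/-! ### (C,F)-measures and balanced rank -/

/-- `μ` is the (C,F)-measure associated with the vectors `lam n = (lam n 1, …, lam n k)`:
`μ [A]_n = ∑_i #A^i * lam n i` for all `A ⊆ F_n`. -/
def IsCFMeasure (lam : ℕ → Fin k → ℝ≥0) (μ : Measure D.Space) : Prop :=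
  ∀ (n : ℕ) (A : Finset (ℤ × Fin k)), A ⊆ D.F n →
    μ (D.cyl n {f | f ∈ A}) = ∑ i : Fin k, ((A.filter fun f => f.2 = i).card : ℝ≥0∞) * lam n i

/-- The (C,F)-action with the (C,F)-measure `μ` is defined almost everywhere, `μ X_0 = 1`, the
parts of `X_0` in the towers have measures with positive limits `δ_j`, and the measures
of the bases of the towers, as well as the columns of the matrices `(r_n^{i,j})`, are
asymptotically proportional to a vector `Λ` with *positive* entries. (When the action is ergodic,
these conditions imply that the transformation induced on `X_0` is ergodic and of exact rank
at most `k`, with the parts of `X_0` in the towers as towers.) -/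
structure IsBalanced (lam : ℕ → Fin k → ℝ≥0) (μ : Measure D.Space) : Prop where
  isCFMeasure : D.IsCFMeasure lam μ
  null_compl_domain : μ D.domainᶜ = 0
  measure_base : μ D.base = 1
  exists_delta : ∃ δ : Fin k → ℝ, (∀ j, 0 < δ j) ∧ ∑ j, δ j = 1 ∧
    ∀ j, Tendsto (fun n => μ.real (D.base ∩ D.cyl n {f | f ∈ D.F n ∧ f.2 = j})) atTop (𝓝 (δ j))
  exists_Lambda : ∃ Λ : Fin k → ℝ, (∀ i, 0 < Λ i) ∧ ∑ i, Λ i = 1 ∧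
    (∀ i, Tendsto (fun n => (lam n i : ℝ) / ∑ j, (lam n j : ℝ)) atTop (𝓝 (Λ i))) ∧
    ∀ i j, Tendsto (fun n => (D.copies n i j : ℝ) / ∑ l, (D.copies n l j : ℝ)) atTop (𝓝 (Λ i))

end CFData

/-! ### Notions of infinite ergodic theory -/

/-- Measure theoretic isomorphism of two transformations, up to null sets and up to multiplying
the measure by a positive constant. -/
def IsIsomorphic {Ω Ω' : Type*} [MeasurableSpace Ω] [MeasurableSpace Ω']
    (T : Ω → Ω) (m : Measure Ω) (S : Ω' → Ω') (μ : Measure Ω') : Prop :=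
  ∃ (φ : Ω → Ω') (ψ : Ω' → Ω) (c : ℝ≥0), c ≠ 0 ∧
    MeasurePreserving φ m (c • μ) ∧ Measurable ψ ∧
    (∀ᵐ x ∂m, ψ (φ x) = x) ∧ (∀ᵐ y ∂μ, φ (ψ y) = y) ∧ (∀ᵐ x ∂m, φ (T x) = S (φ x))

/-- `D` with the measure `μ` is a (C,F)-model that shows that `T` is of balanced finite rank. -/
def IsBalancedModel {Ω : Type*} [MeasurableSpace Ω] (T : Ω ≃ᵐ Ω) (m : Measure Ω)
    {k : ℕ} (D : CFData k) (lam : ℕ → Fin k → ℝ≥0) (μ : Measure D.Space) : Prop :=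
  D.IsBalanced lam μ ∧ IsIsomorphic T m (D.act 1) μ

/-- `T` is of balanced finite rank. -/
def IsBalancedFiniteRank {Ω : Type*} [MeasurableSpace Ω] (T : Ω ≃ᵐ Ω) (m : Measure Ω) : Prop :=
  ∃ (k : ℕ) (D : CFData k) (lam : ℕ → Fin k → ℝ≥0) (μ : Measure D.Space),
    IsBalancedModel T m D lam μ

/-- `T` is subsequence weakly rationally ergodic: for some set `Y` of finite positive measure and
some increasing sequence `h`, with `a_n = ∑_{j < h_n} m (Y ∩ T^j Y) / m(Y)^2`, the sequence
`(1 / a_n) ∑_{j < h_n} m (A ∩ T^j B)` converges to `m A * m B` for all measurable `A, B ⊆ Y`. -/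
def IsSubseqWeaklyRationallyErgodic {Ω : Type*} [MeasurableSpace Ω] (T : Ω ≃ᵐ Ω)
    (m : Measure Ω) : Prop :=
  ∃ (h : ℕ → ℕ) (Y : Set Ω), StrictMono h ∧ MeasurableSet Y ∧ 0 < m Y ∧ m Y < ∞ ∧
    ∀ A B : Set Ω, MeasurableSet A → MeasurableSet B → A ⊆ Y → B ⊆ Y →
      Tendsto (fun n => (∑ j ∈ Finset.range (h n), m.real (A ∩ (⇑T)^[j] '' B)) /
          ∑ j ∈ Finset.range (h n), m.real (Y ∩ (⇑T)^[j] '' Y) / m.real Y ^ 2)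
        atTop (𝓝 (m.real A * m.real B))

/-- `T` is non-squashable: every nonsingular (not necessarily invertible) transformation that
commutes with `T` almost everywhere preserves the measure. -/
def IsNonSquashable {Ω : Type*} [MeasurableSpace Ω] (T : Ω ≃ᵐ Ω) (m : Measure Ω) : Prop :=
  ∀ Q : Ω → Ω, Measurable Q → (∀ A : Set Ω, MeasurableSet A → (m (Q ⁻¹' A) = 0 ↔ m A = 0)) →
    (∀ᵐ x ∂m, Q (T x) = T (Q x)) → MeasurePreserving Q m m

/-! Write `Y` for the copy of `X_0` in `Ω`, and let `b l` be the sum of `m (Y ∩ T⁻ʲ Y)` over `j <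
h_l`, where `h_l` is the least height of a tower of the castle `l`. Everything follows from one
statement: for measurable `B ⊆ Y`, the number of visits to `B` up to time `h_l`, divided by `b l`,
converges weakly to the constant `m B / (m Y)²` on all of `Ω`, tested against integrable functions.

Combinatorial input. Balance makes the columns of the matrices of copies asymptotically proportional
to the measures of the tower bases. Hence, among the levels in `X_0`, those of a fixed cylinder `A ⊆
X_0` have asymptotically the proportion `μ A` in every tower (`tendsto_count_div`). Up to a
coboundary bounded by the number of such levels per tower, visits are counted by complete towers, so
this proportion passes to visits along every orbit segment (`abs_orbitVisits_sub_le`). Used in a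
castle a fixed number of steps below `l`, the estimate has a boundary error negligible against `b
l`. That `b l` has the exact order of the maximal number of visits follows from `orbitVisits_le`
above and, by crossing the lowest tower in both time directions, from `exists_le_corr` below.
Together these give `uniformlyVisited_preimage_base`.

Analytic input. Integrating over subsets of `Y` and exchanging the two sets by time reversal gives
`tendsto_corr_of_subset`, which yields the ratio limit and weak rational ergodicity along a
subsequence. Visit counts change by at most 1 under `T`, while `b l` tends to infinity, so the limit
spreads from `Y` to `Ω` (`UniformlyVisited.averagesTo`). If `Q` commutes with `T`, the visits of `Q
x` to `B` are those of `x` to `Q⁻¹ B`. Comparing the two limits forces `m (Q⁻¹ B) = m B`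
(`isNonSquashable`). -/

/-! ### Bounded sequences of functions with convergent averages -/

/-- The functions `u l` are measurable, and bounded by `C` almost everywhere for large `l`. -/
structure EventuallyBounded {Ω : Type*} [MeasurableSpace Ω] (m : Measure Ω) (u : ℕ → Ω → ℝ)
    (C : ℝ) : Prop where
  aesm : ∀ l, AEStronglyMeasurable (u l) m
  bound : ∀ᶠ l in atTop, ∀ᵐ x ∂m, |u l x| ≤ C

/-- The integrals of `u l` over `E` converge to `c * m E`. -/
def AveragesTo {Ω : Type*} [MeasurableSpace Ω] (m : Measure Ω) (u : ℕ → Ω → ℝ) (c : ℝ)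
    (E : Set Ω) : Prop :=
  Tendsto (fun l => ∫ x in E, u l x ∂m) atTop (𝓝 (c * m.real E))

section Averages

variable {Ω : Type*} [MeasurableSpace Ω] {m : Measure Ω} {u : ℕ → Ω → ℝ} {C c : ℝ}

theorem AveragesTo.congr {E E' : Set Ω} (h : AveragesTo m u c E) (hE : E =ᵐ[m] E') :
    AveragesTo m u c E' := by
  unfold AveragesTo at *
  simp_rw [← setIntegral_congr_set hE, ← measureReal_congr hE]
  exact h

theorem EventuallyBounded.integrableOn (hu : EventuallyBounded m u C) :
    ∀ᶠ l in atTop, ∀ E : Set Ω, m E < ∞ → IntegrableOn (u l) E m := by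
  filter_upwards [hu.bound] with l hl E hE
  exact Measure.integrableOn_of_bounded hE.ne (hu.aesm l) (M := C) (ae_restrict_of_ae hl)

theorem EventuallyBounded.norm_setIntegral_le (hu : EventuallyBounded m u C) :
    ∀ᶠ l in atTop, ∀ E : Set Ω, m E < ∞ → ‖∫ x in E, u l x ∂m‖ ≤ C * m.real E := by
  filter_upwards [hu.bound] with l hl E hE
  exact norm_setIntegral_le_of_norm_le_const_ae hE (by
    filter_upwards [ae_restrict_of_ae hl] with x hx using hx)

/-- Dominated convergence for series: the integral over `E i` is at most `C * m.real (E i)` for all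
large `l` at once, and these bounds are summable because the union has finite measure. -/
theorem EventuallyBounded.averagesTo_iUnion (hu : EventuallyBounded m u C) {E : ℕ → Set Ω}
    (hm : ∀ i, MeasurableSet (E i)) (hd : Pairwise (Function.onFun Disjoint E))
    (hfin : m (⋃ i, E i) < ∞) (h : ∀ i, AveragesTo m u c (E i)) :
    AveragesTo m u c (⋃ i, E i) := by
  have hfi : ∀ i, m (E i) < ∞ := fun i => (measure_mono (Set.subset_iUnion E i)).trans_lt hfin
  have hs : HasSum (fun i => m.real (E i)) (m.real (⋃ i, E i)) := by
    have h1 : m (⋃ i, E i) = ∑' i, m (E i) := measure_iUnion hd hm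
    have h2 : ∑' i, m (E i) ≠ ∞ := h1 ▸ hfin.ne
    have h3 := ENNReal.summable_toReal h2
    have h4 : m.real (⋃ i, E i) = ∑' i, m.real (E i) := by
      rw [measureReal_def, h1, ENNReal.tsum_toReal_eq fun i => (hfi i).ne]
      rfl
    exact h4 ▸ h3.hasSum
  have key : Tendsto (fun l => ∑' i, ∫ x in E i, u l x ∂m) atTop
      (𝓝 (∑' i, c * m.real (E i))) := by
    refine tendsto_tsum_of_dominated_convergence (bound := fun i => C * m.real (E i))
      (hs.summable.mul_left C) h ?_
    filter_upwards [hu.norm_setIntegral_le] with l hl i using hl _ (hfi i)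
  rw [tsum_mul_left, hs.tsum_eq] at key
  refine key.congr' ?_
  filter_upwards [hu.integrableOn] with l hl
  exact (integral_iUnion hm hd (hl _ hfin)).symm

theorem EventuallyBounded.averagesTo_diff (hu : EventuallyBounded m u C) {E F : Set Ω}
    (hE : MeasurableSet E) (hEF : E ⊆ F) (hfin : m F < ∞)
    (h : AveragesTo m u c E) (h' : AveragesTo m u c F) : AveragesTo m u c (F \ E) := by
  unfold AveragesTo at *
  have := h'.sub h
  rw [← mul_sub, ← measureReal_sdiff hEF hE hfin.ne] at this
  refine this.congr' ?_
  filter_upwards [hu.integrableOn] with l hl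
  rw [setIntegral_sdiff hE (hl _ hfin) hEF]

/-- Convergence of the averages extends from a π-system to the σ-algebra it generates, modulo
null sets. -/
theorem EventuallyBounded.averagesTo_of_isPiSystem (hu : EventuallyBounded m u C)
    {Y : Set Ω} (hY : MeasurableSet Y) (hYfin : m Y < ∞) {S : Set (Set Ω)} (hpi : IsPiSystem S)
    (hS : ∀ s ∈ S, MeasurableSet s)
    (hgen : ∀ A : Set Ω, MeasurableSet A →
      ∃ s, MeasurableSet[MeasurableSpace.generateFrom S] s ∧ A =ᵐ[m] s)
    (h0 : AveragesTo m u c Y) (h1 : ∀ s ∈ S, AveragesTo m u c (s ∩ Y)) {E : Set Ω}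
    (hE : MeasurableSet E) (hEY : E ⊆ Y) : AveragesTo m u c E := by
  have hle : MeasurableSpace.generateFrom S ≤ ‹MeasurableSpace Ω› :=
    MeasurableSpace.generateFrom_le hS
  have hfin : ∀ s : Set Ω, m (s ∩ Y) < ∞ := fun s =>
    (measure_mono Set.inter_subset_right).trans_lt hYfin
  have key : ∀ s, MeasurableSet[MeasurableSpace.generateFrom S] s →
      AveragesTo m u c (s ∩ Y) := by
    intro s hs
    induction s, hs using MeasurableSpace.induction_on_inter (s := S) (h_eq := rfl) hpi with
    | empty => simp [AveragesTo]
    | basic t ht => exact h1 t ht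
    | compl t ht ih =>
      have := hu.averagesTo_diff ((hle _ ht).inter hY) Set.inter_subset_right hYfin ih h0
      rwa [show Y \ (t ∩ Y) = tᶜ ∩ Y by ext; simp; tauto] at this
    | iUnion f hd hf ih =>
      rw [Set.iUnion_inter]
      refine hu.averagesTo_iUnion (fun i => (hle _ (hf i)).inter hY) (fun i j hij =>
        (hd hij).mono Set.inter_subset_left Set.inter_subset_left) ?_ ih
      rw [← Set.iUnion_inter]
      exact hfin _
  obtain ⟨s, hs, hEs⟩ := hgen E hE
  refine (key s hs).congr ?_
  have : (E ∩ Y : Set Ω) =ᵐ[m] (s ∩ Y : Set Ω) := hEs.inter (ae_eq_refl Y)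
  rw [Set.inter_eq_left.2 hEY] at this
  exact this.symm

/-- Averages over sets of finite measure determine the averages with respect to any absolutely
continuous finite measure. -/
theorem EventuallyBounded.tendsto_integral [SigmaFinite m] (hu : EventuallyBounded m u C)
    (h : ∀ E, MeasurableSet E → m E < ∞ → AveragesTo m u c E) {ν : Measure Ω} [IsFiniteMeasure ν]
    (hν : ν ≪ m) : Tendsto (fun l => ∫ x, u l x ∂ν) atTop (𝓝 (c * ν.real Set.univ)) := by
  have hC : 0 ≤ |C| := abs_nonneg C
  have hb : ∀ᶠ l in atTop, ∀ᵐ x ∂m, ‖u l x‖ ≤ |C| := by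
    filter_upwards [hu.bound] with l hl
    filter_upwards [hl] with x hx using hx.trans (le_abs_self C)
  have hint : ∀ᶠ l in atTop, ∀ f : Ω → ℝ, Integrable f m → Integrable (fun x => f x * u l x) m := by
    filter_upwards [hb] with l hl f hf
    exact hf.mul_bdd (hu.aesm l) hl
  have key : ∀ f : Ω → ℝ, Integrable f m →
      Tendsto (fun l => ∫ x, f x * u l x ∂m) atTop (𝓝 (c * ∫ x, f x ∂m)) := by
    intro f hf
    refine Integrable.induction (μ := m) (fun f : Ω → ℝ =>
      Tendsto (fun l => ∫ x, f x * u l x ∂m) atTop (𝓝 (c * ∫ x, f x ∂m))) ?_ ?_ ?_ ?_ hf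
    · intro r s hs hfin
      have := (h s hs hfin).const_mul r
      have e : ∀ l, ∫ x, s.indicator (fun _ => r) x * u l x ∂m = r * ∫ x in s, u l x ∂m := by
        intro l
        rw [← integral_const_mul, ← integral_indicator hs]
        congr 1 with x
        by_cases hx : x ∈ s <;> simp [hx]
      simp_rw [e, integral_indicator_const _ hs, smul_eq_mul]
      convert this using 2
      ring
    · intro f g _ hf hg hPf hPg
      have := hPf.add hPg
      rw [← mul_add, ← integral_add hf hg] at this
      refine this.congr' ?_
      filter_upwards [hint] with l hl
      rw [← integral_add (hl f hf) (hl g hg)]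
      congr 1 with x
      simp [add_mul]
    -- For large `l` the functionals `f ↦ ∫ f * u l` have norm at most `|C|` on `L¹`, so the set of
    -- good `f` is closed by a three-term estimate.
    · rw [← isSeqClosed_iff_isClosed]
      intro f g hf hfg
      rw [Set.mem_ofPred_eq, Metric.tendsto_atTop]
      intro ε hε
      have hpos : 0 < |C| + |c| + 1 := by positivity
      obtain ⟨n, hn⟩ := ((Metric.tendsto_atTop.1 hfg) (ε / 2 / (|C| + |c| + 1)) (by positivity))
      have hn := hn n le_rfl
      have hfn := (Metric.tendsto_nhds.1 (hf n)) (ε / 2) (by positivity)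
      obtain ⟨N, hN⟩ := eventually_atTop.1 (hfn.and (hb.and hint))
      refine ⟨N, fun l hl => ?_⟩
      obtain ⟨h1, h2, h3⟩ := hN l hl
      rw [L1.dist_eq_integral_dist] at hn
      have hfi := L1.integrable_coeFn (f n)
      have hgi := L1.integrable_coeFn g
      have hdi : Integrable (fun x => dist (f n x) (g x)) m := by
        simp_rw [dist_eq_norm]
        exact (hfi.sub hgi).norm
      set d := ∫ x, dist (f n x) (g x) ∂m
      have hd0 : 0 ≤ d := integral_nonneg fun x => dist_nonneg
      have e1 : |∫ x, g x * u l x ∂m - ∫ x, f n x * u l x ∂m| ≤ |C| * d := by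
        rw [← integral_sub (h3 _ hgi) (h3 _ hfi), ← integral_const_mul, ← Real.norm_eq_abs]
        refine norm_integral_le_of_norm_le (hdi.const_mul _) ?_
        filter_upwards [h2] with x hx
        rw [← sub_mul, norm_mul, mul_comm, dist_comm, dist_eq_norm]
        exact mul_le_mul_of_nonneg_right hx (norm_nonneg _)
      have e2 : |c * ∫ x, g x ∂m - c * ∫ x, f n x ∂m| ≤ |c| * d := by
        rw [← mul_sub, abs_mul, ← integral_sub hgi hfi]
        gcongr
        rw [← Real.norm_eq_abs]
        refine norm_integral_le_of_norm_le hdi ?_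
        filter_upwards with x
        rw [dist_comm, Real.dist_eq, Real.norm_eq_abs]
      rw [Real.dist_eq] at h1 ⊢
      have e3 : (|C| + |c| + 1) * d < ε / 2 := by
        rw [lt_div_iff₀ hpos] at hn
        linarith
      have e4 : (|C| + |c| + 1) * d = |C| * d + |c| * d + d := by ring
      have : |∫ x, g x * u l x ∂m - c * ∫ x, g x ∂m| ≤
          |∫ x, g x * u l x ∂m - ∫ x, f n x * u l x ∂m| +
          |∫ x, f n x * u l x ∂m - c * ∫ x, f n x ∂m| +
          |c * ∫ x, g x ∂m - c * ∫ x, f n x ∂m| := by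
        rw [abs_sub_comm (c * ∫ x, g x ∂m)]
        exact (abs_sub_le _ (c * ∫ x, f n x ∂m) _).trans
          (add_le_add_left (abs_sub_le _ _ _) _)
      linarith
    · intro f g hfg _ hf
      rw [integral_congr_ae hfg] at hf
      refine hf.congr fun l => integral_congr_ae ?_
      filter_upwards [hfg] with x hx
      rw [hx]
  -- The density of `ν` is the integrable test function.
  have := key (fun x => (ν.rnDeriv m x).toReal) Measure.integrable_toReal_rnDeriv
  rw [Measure.integral_toReal_rnDeriv hν] at this
  refine this.congr fun l => ?_
  simp_rw [← smul_eq_mul]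
  exact integral_rnDeriv_smul hν

end Averages

/-! ### Numbers of visits and correlation sums -/

/-- The number of visits to `B` among the first `h` points of the orbit of `x`. -/
noncomputable def visits {Ω : Type*} (T : Ω → Ω) (B : Set Ω) (h : ℕ) (x : Ω) : ℝ :=
  ∑ j ∈ Finset.range h, B.indicator 1 (T^[j] x)

/-- The sum of the measures of `E ∩ T⁻ʲ B` over `j < h`. -/
noncomputable def corr {Ω : Type*} [MeasurableSpace Ω] (m : Measure Ω) (T : Ω → Ω) (E B : Set Ω)
    (h : ℕ) : ℝ :=
  ∑ j ∈ Finset.range h, m.real (E ∩ T^[j] ⁻¹' B)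

section Visits

variable {Ω : Type*}

theorem visits_nonneg (T : Ω → Ω) (B : Set Ω) (h : ℕ) (x : Ω) : 0 ≤ visits T B h x :=
  Finset.sum_nonneg fun _ _ => Set.indicator_nonneg (fun _ _ => zero_le_one) _

theorem visits_mono (T : Ω → Ω) {B B' : Set Ω} (hB : B ⊆ B') (h : ℕ) (x : Ω) :
    visits T B h x ≤ visits T B' h x :=
  Finset.sum_le_sum fun _ _ => Set.indicator_le_indicator_of_subset hB (fun _ => zero_le_one) _

/-- The two sums telescope to the terms at times `h` and `0`. -/
theorem visits_apply_sub (T : Ω → Ω) (B : Set Ω) (h : ℕ) (x : Ω) :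
    |visits T B h (T x) - visits T B h x| ≤ 1 := by
  have : visits T B h (T x) - visits T B h x = B.indicator 1 (T^[h] x) - B.indicator 1 x :=
    birkhoffSum_apply_sub_birkhoffSum T (B.indicator (1 : Ω → ℝ)) h x
  rw [this]
  by_cases h1 : T^[h] x ∈ B <;> by_cases h2 : x ∈ B <;> simp [h1, h2]

variable [MeasurableSpace Ω] {m : Measure Ω}

/-- A backward orbit segment is a forward one read from its far end. Almost everywhere bounds on
visits therefore transfer to the inverse transformation. -/
theorem visits_symm (T : Ω ≃ᵐ Ω) (B : Set Ω) (h : ℕ) (x : Ω) :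
    visits T.symm B h x = visits T B h (T.symm^[h - 1] x) := by
  unfold visits
  rw [← Finset.sum_range_reflect]
  refine Finset.sum_congr rfl fun j hj => ?_
  have hj' : h - 1 = j + (h - 1 - j) := by have := Finset.mem_range.1 hj; omega
  conv_rhs => rw [hj', Function.iterate_add_apply]
  rw [(Function.LeftInverse.iterate T.apply_symm_apply j) _]

theorem measurable_visits {T : Ω → Ω} (hT : Measurable T) {B : Set Ω} (hB : MeasurableSet B)
    (h : ℕ) : Measurable (visits T B h) :=
  Finset.measurable_sum _ fun j _ => (measurable_one.indicator hB).comp (hT.iterate j)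

theorem setIntegral_visits {T : Ω → Ω} (hT : Measurable T) {B : Set Ω} (hB : MeasurableSet B)
    (h : ℕ) {E : Set Ω} (hfin : m E ≠ ∞) :
    ∫ x in E, visits T B h x ∂m = corr m T E B h := by
  unfold visits corr
  have hm : ∀ j, MeasurableSet (T^[j] ⁻¹' B) := fun j => (hT.iterate j) hB
  have : IsFiniteMeasure (m.restrict E) := ⟨by simpa using hfin.lt_top⟩
  have e : ∀ j x, B.indicator (1 : Ω → ℝ) (T^[j] x) = (T^[j] ⁻¹' B).indicator 1 x := fun j x => rfl
  simp_rw [e]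
  rw [integral_finsetSum]
  · refine Finset.sum_congr rfl fun j _ => ?_
    rw [integral_indicator_one (hm j), measureReal_restrict_apply (hm j), Set.inter_comm]
  · intro j _
    exact (integrable_const (1 : ℝ)).indicator (hm j)

theorem corr_symm {T : Ω ≃ᵐ Ω} (hT : MeasurePreserving T m m) {E B : Set Ω}
    (hE : MeasurableSet E) (hB : MeasurableSet B) (h : ℕ) :
    corr m T E B h = corr m T.symm B E h := by
  refine Finset.sum_congr rfl fun j _ => ?_
  have h1 : E ∩ T^[j] ⁻¹' B = T^[j] ⁻¹' (B ∩ T.symm^[j] ⁻¹' E) := by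
    ext x
    simp [(Function.LeftInverse.iterate T.symm_apply_apply j) x, and_comm]
  rw [h1]
  exact (hT.iterate j).measureReal_preimage
    (hB.inter ((T.symm.measurable.iterate j) hE)).nullMeasurableSet

theorem corr_mono_right {T : Ω → Ω} {E B B' : Set Ω} (hE : m E ≠ ∞) (hB : B ⊆ B') (h : ℕ) :
    corr m T E B h ≤ corr m T E B' h :=
  Finset.sum_le_sum fun _ _ => measureReal_mono
    (Set.inter_subset_inter_right _ (Set.preimage_mono hB))
    (measure_mono Set.inter_subset_left |>.trans_lt hE.lt_top).ne

end Visits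

/-! ### Sets with uniformly distributed visits -/

/-- The numbers of visits to `Y` during the times `h l` are at most of the order of `b l`, their
average over `Y`, and the visits to the members of a generating π-system of subsets of `Y` are
uniformly distributed among them. -/
structure UniformlyVisited {Ω : Type*} [MeasurableSpace Ω] (m : Measure Ω) (T : Ω ≃ᵐ Ω)
    (Y : Set Ω) (h : ℕ → ℕ) (b : ℕ → ℝ) : Prop where
  measurePreserving : MeasurePreserving T m m
  measurableSet : MeasurableSet Y
  measure_ne_zero : m Y ≠ 0
  measure_ne_top : m Y ≠ ∞
  tendsto_atTop : Tendsto b atTop atTop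
  eq_corr : ∀ l, b l = corr m T Y Y (h l)
  bound : ∃ C : ℝ, ∀ᶠ l in atTop, ∀ᵐ x ∂m, visits T Y (h l) x ≤ C * b l
  sweep : ∀ᵐ x ∂m, ∃ n : ℕ, T^[n] x ∈ Y ∨ T.symm^[n] x ∈ Y
  generate : ∃ S : Set (Set Ω), IsPiSystem S ∧ (∀ s ∈ S, MeasurableSet s) ∧
    (∀ A : Set Ω, MeasurableSet A →
      ∃ s, MeasurableSet[MeasurableSpace.generateFrom S] s ∧ A =ᵐ[m] s) ∧
    ∀ s ∈ S, ∀ ε > 0, ∀ᶠ l in atTop, ∀ᵐ x ∂m,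
      |visits T (s ∩ Y) (h l) x - m.real (s ∩ Y) / m.real Y * visits T Y (h l) x| ≤ ε * b l

namespace UniformlyVisited

variable {Ω : Type*} [MeasurableSpace Ω] {m : Measure Ω} {T : Ω ≃ᵐ Ω} {Y : Set Ω} {h : ℕ → ℕ}
  {b : ℕ → ℝ}

theorem symm (H : UniformlyVisited m T Y h b) : UniformlyVisited m T.symm Y h b where
  measurePreserving := H.measurePreserving.symm
  measurableSet := H.measurableSet
  measure_ne_zero := H.measure_ne_zero
  measure_ne_top := H.measure_ne_top
  tendsto_atTop := H.tendsto_atTop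
  eq_corr l := by
    rw [H.eq_corr, corr_symm H.measurePreserving H.measurableSet H.measurableSet]
  bound := by
    obtain ⟨C, hC⟩ := H.bound
    refine ⟨C, ?_⟩
    filter_upwards [hC] with l hl
    simp_rw [visits_symm]
    exact (H.measurePreserving.symm.iterate _).quasiMeasurePreserving.ae hl
  sweep := by
    filter_upwards [H.sweep] with x ⟨n, hn⟩
    exact ⟨n, hn.symm⟩
  generate := by
    obtain ⟨S, h1, h2, h3, h4⟩ := H.generate
    refine ⟨S, h1, h2, h3, fun s hs ε hε => ?_⟩
    filter_upwards [h4 s hs ε hε] with l hl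
    simp_rw [visits_symm]
    exact (H.measurePreserving.symm.iterate _).quasiMeasurePreserving.ae hl

theorem measureReal_pos (H : UniformlyVisited m T Y h b) : 0 < m.real Y :=
  ENNReal.toReal_pos H.measure_ne_zero H.measure_ne_top

theorem exists_eventuallyBounded (H : UniformlyVisited m T Y h b) {B : Set Ω}
    (hB : MeasurableSet B) (hBY : B ⊆ Y) :
    ∃ C, EventuallyBounded m (fun l x => visits T B (h l) x / b l) C := by
  obtain ⟨C, hC⟩ := H.bound
  refine ⟨C, fun l => ((measurable_visits T.measurable hB _).div_const _).aestronglyMeasurable, ?_⟩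
  filter_upwards [hC, H.tendsto_atTop.eventually_gt_atTop 0] with l hl hb
  filter_upwards [hl] with x hx
  rw [abs_of_nonneg (div_nonneg (visits_nonneg _ _ _ _) hb.le), div_le_iff₀ hb]
  exact (visits_mono _ hBY _ _).trans hx

theorem averagesTo_iff {B : Set Ω} (hB : MeasurableSet B)
    {E : Set Ω} (hE : m E ≠ ∞) {c : ℝ} :
    AveragesTo m (fun l x => visits T B (h l) x / b l) c E ↔
      Tendsto (fun l => corr m T E B (h l) / b l) atTop (𝓝 (c * m.real E)) := by
  unfold AveragesTo
  simp_rw [integral_div, setIntegral_visits T.measurable hB _ hE]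

/-- The integrated form of `generate`, in both time directions: the pointwise error `ε * b l`
becomes at most `ε * m.real E` after integration over `E` and division by `b l`. -/
theorem exists_approx (H : UniformlyVisited m T Y h b) :
    ∃ S : Set (Set Ω), IsPiSystem S ∧ (∀ s ∈ S, MeasurableSet s) ∧
    (∀ A : Set Ω, MeasurableSet A →
      ∃ s, MeasurableSet[MeasurableSpace.generateFrom S] s ∧ A =ᵐ[m] s) ∧
    ∀ s ∈ S, ∀ E : Set Ω, E ⊆ Y →
      Tendsto (fun l => corr m T E (s ∩ Y) (h l) / b l
        - m.real (s ∩ Y) / m.real Y * (corr m T E Y (h l) / b l)) atTop (𝓝 0) ∧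
      Tendsto (fun l => corr m T.symm E (s ∩ Y) (h l) / b l
        - m.real (s ∩ Y) / m.real Y * (corr m T.symm E Y (h l) / b l)) atTop (𝓝 0) := by
  obtain ⟨S, h1, h2, h3, h4⟩ := H.generate
  refine ⟨S, h1, h2, h3, fun s hs E hEY => ?_⟩
  have hE : m E < ∞ := (measure_mono hEY).trans_lt H.measure_ne_top.lt_top
  have : IsFiniteMeasure (m.restrict E) := ⟨by simpa using hE⟩
  have key : ∀ R : Ω ≃ᵐ Ω, (∀ ε > 0, ∀ᶠ l in atTop, ∀ᵐ x ∂m,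
      |visits R (s ∩ Y) (h l) x - m.real (s ∩ Y) / m.real Y * visits R Y (h l) x| ≤ ε * b l) →
      Tendsto (fun l => corr m R E (s ∩ Y) (h l) / b l
        - m.real (s ∩ Y) / m.real Y * (corr m R E Y (h l) / b l)) atTop (𝓝 0) := by
    intro R hR
    rw [Metric.tendsto_nhds]
    intro ε hε
    have hpos : 0 < m.real E + 1 := by positivity
    filter_upwards [hR (ε / (m.real E + 1)) (by positivity),
      H.tendsto_atTop.eventually_gt_atTop 0] with l hl hb
    have hint : ∀ B, MeasurableSet B → IntegrableOn (visits R B (h l)) E m := by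
      intro B hB
      refine integrable_finsetSum _ fun j _ => ?_
      exact (integrable_const (1 : ℝ)).indicator ((R.measurable.iterate j) hB)
    rw [← setIntegral_visits R.measurable ((h2 s hs).inter H.measurableSet) _ hE.ne,
      ← setIntegral_visits R.measurable H.measurableSet _ hE.ne, ← mul_div_assoc,
      ← sub_div, ← integral_const_mul, ← integral_sub (hint _ ((h2 s hs).inter H.measurableSet))
        ((hint _ H.measurableSet).const_mul _), dist_zero_right, norm_div,
        Real.norm_of_nonneg hb.le, div_lt_iff₀ hb]
    refine (norm_setIntegral_le_of_norm_le_const_ae hE (ae_restrict_of_ae hl)).trans_lt ?_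
    rw [mul_right_comm]
    refine mul_lt_mul_of_pos_right ?_ hb
    rw [div_mul_eq_mul_div, div_lt_iff₀ hpos]
    nlinarith
  refine ⟨key T (h4 s hs), key T.symm fun ε hε => ?_⟩
  filter_upwards [h4 s hs ε hε] with l hl
  simp_rw [visits_symm]
  exact (H.measurePreserving.symm.iterate _).quasiMeasurePreserving.ae hl

/-- On a generator `s ∩ Y`, time reversal turns the sum of visits from `s ∩ Y` to `Y` into one from
`Y` to `s ∩ Y`, which is about `m (s ∩ Y) / m Y` times `b l`. The π-system argument does the rest.
The constant is left unreduced to match the case `B = Y` of `averagesTo`. -/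
theorem averagesTo_base (H : UniformlyVisited m T Y h b) {E : Set Ω} (hE : MeasurableSet E)
    (hEY : E ⊆ Y) :
    AveragesTo m (fun l x => visits T Y (h l) x / b l) (m.real Y / m.real Y ^ 2) E := by
  have hy := H.measureReal_pos
  obtain ⟨C, hC⟩ := H.exists_eventuallyBounded H.measurableSet subset_rfl
  obtain ⟨S, h1, h2, h3, h4⟩ := H.exists_approx
  have hcorr : ∀ᶠ l in atTop, corr m T Y Y (h l) / b l = 1 := by
    filter_upwards [H.tendsto_atTop.eventually_gt_atTop 0] with l hb
    rw [← H.eq_corr, div_self hb.ne']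
  refine hC.averagesTo_of_isPiSystem H.measurableSet H.measure_ne_top.lt_top h1 h2 h3 ?_ ?_ hE hEY
  · rw [averagesTo_iff H.measurableSet H.measure_ne_top]
    refine tendsto_const_nhds.congr' (f₁ := fun _ => _) ?_
    filter_upwards [hcorr] with l hl
    rw [hl]
    field_simp
  · intro s hs
    rw [averagesTo_iff H.measurableSet
      (measure_mono Set.inter_subset_right |>.trans_lt H.measure_ne_top.lt_top).ne]
    have := (h4 s hs Y subset_rfl).2.add_const (m.real (s ∩ Y) / m.real Y)
    rw [zero_add] at this
    rw [show m.real Y / m.real Y ^ 2 * m.real (s ∩ Y) = m.real (s ∩ Y) / m.real Y by field_simp]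
    refine this.congr' ?_
    filter_upwards [hcorr] with l hl
    rw [← corr_symm H.measurePreserving H.measurableSet H.measurableSet, hl,
      ← corr_symm H.measurePreserving ((h2 s hs).inter H.measurableSet) H.measurableSet]
    ring

/-- Now `E` is fixed and `B` varies: reversed visits to `E` are averaged over `B`. For `B = s ∩ Y`
the sum is a known proportion of the one for `Y`, whose limit is `averagesTo_base`. -/
theorem tendsto_corr_of_subset (H : UniformlyVisited m T Y h b) {E B : Set Ω}
    (hE : MeasurableSet E) (hEY : E ⊆ Y) (hB : MeasurableSet B) (hBY : B ⊆ Y) :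
    Tendsto (fun l => corr m T E B (h l) / b l) atTop
      (𝓝 (m.real B / m.real Y ^ 2 * m.real E)) := by
  have hy := H.measureReal_pos
  have hfin : ∀ {A}, A ⊆ Y → m A ≠ ∞ := fun hA =>
    (measure_mono hA |>.trans_lt H.measure_ne_top.lt_top).ne
  obtain ⟨C, hC⟩ := H.symm.exists_eventuallyBounded hE hEY
  obtain ⟨S, h1, h2, h3, h4⟩ := H.exists_approx
  have hbase := (averagesTo_iff H.measurableSet (hfin hEY)).1 (H.averagesTo_base hE hEY)
  have := hC.averagesTo_of_isPiSystem (c := m.real E / m.real Y ^ 2) H.measurableSet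
    H.measure_ne_top.lt_top h1 h2 h3 ?_ ?_ hB hBY
  · rw [averagesTo_iff hE (hfin hBY)] at this
    simp_rw [corr_symm H.measurePreserving hE hB]
    convert this using 2
    ring
  · rw [averagesTo_iff hE H.measure_ne_top]
    simp_rw [← corr_symm H.measurePreserving hE H.measurableSet]
    convert hbase using 2
    ring
  · intro s hs
    rw [averagesTo_iff hE (hfin Set.inter_subset_right)]
    simp_rw [← corr_symm H.measurePreserving hE ((h2 s hs).inter H.measurableSet)]
    have := (h4 s hs E hEY).1.add (hbase.const_mul (m.real (s ∩ Y) / m.real Y))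
    convert this using 2
    · ring
    · field_simp
      ring

/-- Visit counts are invariant up to 1, so the two integrals differ by at most `m E / b l`, which
tends to 0. -/
theorem averagesTo_preimage_iff (H : UniformlyVisited m T Y h b) {B : Set Ω}
    (hB : MeasurableSet B) {E : Set Ω} (hE : MeasurableSet E) (hfin : m E ≠ ∞) {c : ℝ} :
    AveragesTo m (fun l x => visits T B (h l) x / b l) c (T ⁻¹' E) ↔
      AveragesTo m (fun l x => visits T B (h l) x / b l) c E := by
  have hpre : m (T ⁻¹' E) = m E := H.measurePreserving.measure_preimage hE.nullMeasurableSet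
  have hpre' : m.real (T ⁻¹' E) = m.real E := by simp [measureReal_def, hpre]
  have hint : ∀ n, IntegrableOn (visits T B n) (T ⁻¹' E) m := by
    intro n
    have : IsFiniteMeasure (m.restrict (T ⁻¹' E)) := ⟨by simpa [hpre] using hfin.lt_top⟩
    refine integrable_finsetSum _ fun j _ => ?_
    exact (integrable_const (1 : ℝ)).indicator ((T.measurable.iterate j) hB)
  have hint' : ∀ n, IntegrableOn (fun x => visits T B n (T x)) (T ⁻¹' E) m := by
    intro n
    have : IsFiniteMeasure (m.restrict (T ⁻¹' E)) := ⟨by simpa [hpre] using hfin.lt_top⟩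
    refine integrable_finsetSum _ fun j _ => ?_
    exact (integrable_const (1 : ℝ)).indicator (((T.measurable.iterate j).comp T.measurable) hB)
  have hdiff : Tendsto (fun l => (∫ x in E, visits T B (h l) x / b l ∂m) -
      ∫ x in T ⁻¹' E, visits T B (h l) x / b l ∂m) atTop (𝓝 0) := by
    have h0 : Tendsto (fun l => m.real E / b l) atTop (𝓝 0) :=
      tendsto_const_nhds.div_atTop H.tendsto_atTop
    refine squeeze_zero_norm' ?_ h0
    filter_upwards [H.tendsto_atTop.eventually_gt_atTop 0] with l hb
    rw [← H.measurePreserving.setIntegral_preimage_emb T.measurableEmbedding, integral_div,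
      integral_div, ← sub_div, ← integral_sub (hint' _) (hint _), norm_div,
      Real.norm_of_nonneg hb.le]
    gcongr
    have := norm_setIntegral_le_of_norm_le_const (μ := m) (s := T ⁻¹' E) (C := 1)
      (f := fun x => visits T B (h l) (T x) - visits T B (h l) x) (hpre ▸ hfin.lt_top)
      fun x _ => visits_apply_sub T B (h l) x
    rwa [one_mul, hpre'] at this
  unfold AveragesTo
  rw [hpre']
  constructor
  · intro h1
    simpa using hdiff.add h1
  · intro h1
    simpa using h1.sub hdiff

theorem averagesTo_iterate_preimage_iff (H : UniformlyVisited m T Y h b) {B : Set Ω}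
    (hB : MeasurableSet B) (n : ℕ) {E : Set Ω} (hE : MeasurableSet E) (hfin : m E ≠ ∞) {c : ℝ} :
    AveragesTo m (fun l x => visits T B (h l) x / b l) c (T^[n] ⁻¹' E) ↔
      AveragesTo m (fun l x => visits T B (h l) x / b l) c E := by
  induction n with
  | zero => rfl
  | succ n ih =>
    rw [Function.iterate_succ, Set.preimage_comp, H.averagesTo_preimage_iff hB
      ((T.measurable.iterate n) hE), ih]
    rwa [(H.measurePreserving.iterate n).measure_preimage hE.nullMeasurableSet]

end UniformlyVisited

/-! ### From subsets of `Y` to the whole space; non-squashability. -/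

namespace UniformlyVisited

variable {Ω : Type*} [MeasurableSpace Ω] {m : Measure Ω} {T : Ω ≃ᵐ Ω} {Y : Set Ω} {h : ℕ → ℕ}
  {b : ℕ → ℝ}

/-- Almost every orbit meets `Y`, so up to a null set `E` is a countable disjoint union of pieces,
each of which is a preimage, under an iterate of `T` or of its inverse, of a subset of `Y`. -/
theorem sweep_induction (H : UniformlyVisited m T Y h b) {P : Set Ω → Prop}
    (hae : ∀ A B : Set Ω, MeasurableSet A → MeasurableSet B → A =ᵐ[m] B → P A → P B)
    (hU : ∀ f : ℕ → Set Ω, (∀ i, MeasurableSet (f i)) → Pairwise (Function.onFun Disjoint f) →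
      (∀ i, P (f i)) → P (⋃ i, f i))
    (h1 : ∀ (n : ℕ) (A : Set Ω), MeasurableSet A → A ⊆ Y → P (T^[n] ⁻¹' A))
    (h2 : ∀ (n : ℕ) (A : Set Ω), MeasurableSet A → A ⊆ Y → P (T.symm^[n] ⁻¹' A))
    {E : Set Ω} (hE : MeasurableSet E) : P E := by
  -- Forward and backward preimages of `Y` are interleaved into a single sequence, to be made
  -- disjoint.
  set Z : ℕ → Set Ω := fun i => if Even i then T^[i / 2] ⁻¹' Y else T.symm^[i / 2] ⁻¹' Y with hZ
  have hZm : ∀ i, MeasurableSet (Z i) := by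
    intro i
    simp only [hZ]
    split_ifs
    · exact (T.measurable.iterate _) H.measurableSet
    · exact (T.symm.measurable.iterate _) H.measurableSet
  have hm : ∀ i, MeasurableSet (E ∩ disjointed Z i) := fun i =>
    hE.inter (MeasurableSet.disjointed hZm i)
  have hP : ∀ i, P (E ∩ disjointed Z i) := by
    intro i
    set A := E ∩ disjointed Z i with hA
    have hAZ : A ⊆ Z i := Set.inter_subset_right.trans (disjointed_subset Z i)
    by_cases hi : Even i
    · have e : T^[i / 2] ⁻¹' (T.symm^[i / 2] ⁻¹' A) = A := by
        ext x
        simp [(Function.LeftInverse.iterate T.symm_apply_apply (i / 2)) x]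
      rw [← e]
      refine h1 _ _ ((T.symm.measurable.iterate _) (hm i)) fun x hx => ?_
      have := hAZ hx
      simpa [hZ, hi, (Function.LeftInverse.iterate T.apply_symm_apply (i / 2)) x] using this
    · have e : T.symm^[i / 2] ⁻¹' (T^[i / 2] ⁻¹' A) = A := by
        ext x
        simp [(Function.LeftInverse.iterate T.apply_symm_apply (i / 2)) x]
      rw [← e]
      refine h2 _ _ ((T.measurable.iterate _) (hm i)) fun x hx => ?_
      have := hAZ hx
      simpa [hZ, hi, (Function.LeftInverse.iterate T.symm_apply_apply (i / 2)) x] using this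
  refine hae (⋃ i, E ∩ disjointed Z i) E (MeasurableSet.iUnion hm) hE ?_ (hU _ hm (fun i j hij =>
    (disjoint_disjointed Z hij).mono Set.inter_subset_right Set.inter_subset_right) hP)
  rw [← Set.inter_iUnion, iUnion_disjointed]
  have hcov : (⋃ i, Z i : Set Ω) =ᵐ[m] Set.univ := by
    rw [eventuallyEq_univ]
    filter_upwards [H.sweep] with x ⟨n, hn⟩
    rw [Set.mem_iUnion]
    rcases hn with hn | hn
    · exact ⟨2 * n, by simpa [hZ] using hn⟩
    · refine ⟨2 * n + 1, ?_⟩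
      have h1 : ¬ Even (2 * n + 1) := by simp
      have h2 : (2 * n + 1) / 2 = n := by omega
      simp only [hZ, h1, if_false, h2]
      exact hn
  simpa using (ae_eq_refl E).inter hcov

/-- The weak limit of the normalized visits is constant on `Y`, and asymptotic invariance propagates
the same constant along orbits to all of `Ω`. -/
theorem averagesTo (H : UniformlyVisited m T Y h b) {B : Set Ω} (hB : MeasurableSet B)
    (hBY : B ⊆ Y) {E : Set Ω} (hE : MeasurableSet E) (hfin : m E < ∞) :
    AveragesTo m (fun l x => visits T B (h l) x / b l) (m.real B / m.real Y ^ 2) E := by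
  obtain ⟨C, hC⟩ := H.exists_eventuallyBounded hB hBY
  have hbase : ∀ A, MeasurableSet A → A ⊆ Y →
      AveragesTo m (fun l x => visits T B (h l) x / b l) (m.real B / m.real Y ^ 2) A := by
    intro A hA hAY
    rw [averagesTo_iff hB (measure_mono hAY |>.trans_lt H.measure_ne_top.lt_top).ne]
    exact H.tendsto_corr_of_subset hA hAY hB hBY
  have hA : ∀ {A}, A ⊆ Y → m A ≠ ∞ := fun hA =>
    (measure_mono hA |>.trans_lt H.measure_ne_top.lt_top).ne
  refine H.sweep_induction (P := fun A => m A < ∞ →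
    AveragesTo m (fun l x => visits T B (h l) x / b l) (m.real B / m.real Y ^ 2) A)
    (fun A B _ _ hAB hP hfin => (hP ((measure_congr hAB).symm ▸ hfin)).congr hAB) ?_ ?_ ?_ hE hfin
  · exact fun f hf hd hP hfin => hC.averagesTo_iUnion hf hd hfin fun i =>
      hP i ((measure_mono (Set.subset_iUnion f i)).trans_lt hfin)
  · intro n A hAm hAY _
    rw [H.averagesTo_iterate_preimage_iff hB n hAm (hA hAY)]
    exact hbase A hAm hAY
  · intro n A hAm hAY _
    rw [← H.averagesTo_iterate_preimage_iff hB n ((T.symm.measurable.iterate n) hAm)]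
    · convert hbase A hAm hAY using 1
      ext x
      simp [(Function.LeftInverse.iterate T.symm_apply_apply n) x]
    · rw [(H.measurePreserving.symm.iterate n).measure_preimage hAm.nullMeasurableSet]
      exact hA hAY

/-- For `B ⊆ Y`, the average over `Y` of visits to `Q⁻¹ B` equals the average of visits to `B`
against the image of `m` restricted to `Y` under `Q`. This image is absolutely continuous, so the
weak limit applies and gives `m B / m Y`. Computed directly, by reversed visits to `Y`, the limit is
`m (Q⁻¹ B) / m Y`. -/
theorem isNonSquashable [SigmaFinite m] (H : UniformlyVisited m T Y h b) :
    IsNonSquashable T m := by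
  intro Q hQ hnull hcomm
  have hy := H.measureReal_pos
  have hquasi : Measure.QuasiMeasurePreserving Q m m := by
    refine ⟨hQ, Measure.AbsolutelyContinuous.mk fun s hs h0 => ?_⟩
    rw [Measure.map_apply hQ hs, (hnull s hs).2 h0]
  have hiter : ∀ᵐ x ∂m, ∀ j : ℕ, Q (T^[j] x) = T^[j] (Q x) := by
    have : ∀ᵐ x ∂m, ∀ j : ℕ, Q (T (T^[j] x)) = T (Q (T^[j] x)) := ae_all_iff.2 fun j =>
      (H.measurePreserving.iterate j).quasiMeasurePreserving.ae hcomm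
    filter_upwards [this] with x hx j
    induction j with
    | zero => rfl
    | succ j ih => rw [Function.iterate_succ_apply', hx, ih, Function.iterate_succ_apply']
  have hbase : ∀ B, MeasurableSet B → B ⊆ Y → m (Q ⁻¹' B) = m B := by
    intro B hB hBY
    have hBfin : m B < ∞ := (measure_mono hBY).trans_lt H.measure_ne_top.lt_top
    have hYf : IsFiniteMeasure (m.restrict Y) := ⟨by simpa using H.measure_ne_top.lt_top⟩
    obtain ⟨C, hC⟩ := H.exists_eventuallyBounded hB hBY
    have hν : (m.restrict Y).map Q ≪ m :=
      (hquasi.mono_left Measure.absolutelyContinuous_restrict).absolutelyContinuous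
    have hlim := hC.tendsto_integral (fun E hE hfin => H.averagesTo hB hBY hE hfin) hν
    have hmass : ((m.restrict Y).map Q).real Set.univ = m.real Y := by
      rw [map_measureReal_apply hQ MeasurableSet.univ]
      simp
    have hint : ∀ l, ∫ x, visits T B (h l) x / b l ∂((m.restrict Y).map Q) =
        corr m T Y (Q ⁻¹' B) (h l) / b l := by
      intro l
      rw [integral_map hQ.aemeasurable
        ((measurable_visits T.measurable hB _).div_const _).aestronglyMeasurable, integral_div,
        ← setIntegral_visits T.measurable (hQ hB) _ H.measure_ne_top]
      congr 1
      refine integral_congr_ae (ae_restrict_of_ae ?_)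
      filter_upwards [hiter] with x hx
      refine Finset.sum_congr rfl fun j _ => ?_
      rw [← hx j]
      rfl
    simp_rw [hint, hmass] at hlim
    rw [show m.real B / m.real Y ^ 2 * m.real Y = m.real B / m.real Y by field_simp] at hlim
    have hsub : ∀ D, MeasurableSet D → m D < ∞ → Tendsto (fun l => corr m T Y D (h l) / b l) atTop
        (𝓝 (m.real D / m.real Y)) := by
      intro D hD hDfin
      have := (averagesTo_iff H.measurableSet hDfin.ne).1
        (H.symm.averagesTo H.measurableSet subset_rfl hD hDfin)
      simp_rw [corr_symm H.measurePreserving H.measurableSet hD]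
      convert this using 2
      field_simp
    -- The direct computation needs finite measure, not yet known for `Q⁻¹ B`. Its subsets of finite
    -- measure are compared with `B` first, and σ-finiteness then bounds `m (Q⁻¹ B)`.
    have hle : ∀ D, MeasurableSet D → m D < ∞ → D ⊆ Q ⁻¹' B → m D ≤ m B := by
      intro D hD hDfin hDB
      have : m.real D / m.real Y ≤ m.real B / m.real Y := by
        refine le_of_tendsto_of_tendsto (hsub D hD hDfin) hlim ?_
        filter_upwards [H.tendsto_atTop.eventually_gt_atTop 0] with l hb
        gcongr
        exact corr_mono_right H.measure_ne_top hDB _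
      rw [div_le_div_iff_of_pos_right hy] at this
      exact (ENNReal.toReal_le_toReal hDfin.ne hBfin.ne).1 this
    have hle' : m (Q ⁻¹' B) ≤ m B := by
      by_contra! hlt
      obtain ⟨D, hD, hDB, h1, h2⟩ := Measure.exists_subset_measure_lt_top (hQ hB) hlt
      exact absurd (hle D hD h2 hDB) h1.not_ge
    have hfin := hle'.trans_lt hBfin
    have := tendsto_nhds_unique (hsub _ (hQ hB) hfin) hlim
    rw [div_left_inj' hy.ne'] at this
    exact (ENNReal.toReal_eq_toReal_iff' hfin.ne hBfin.ne).1 this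
  have hpre : ∀ B, MeasurableSet B → (m (Q ⁻¹' (T ⁻¹' B)) = m (T ⁻¹' B) ↔ m (Q ⁻¹' B) = m B) := by
    intro B hB
    have e : (Q ⁻¹' (T ⁻¹' B) : Set Ω) =ᵐ[m] (T ⁻¹' (Q ⁻¹' B) : Set Ω) := by
      filter_upwards [hcomm] with x hx
      exact propext (by
        change T (Q x) ∈ B ↔ Q (T x) ∈ B
        rw [hx])
    rw [measure_congr e, H.measurePreserving.measure_preimage (hQ hB).nullMeasurableSet,
      H.measurePreserving.measure_preimage hB.nullMeasurableSet]
  have hpre' : ∀ (n : ℕ) B, MeasurableSet B →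
      (m (Q ⁻¹' (T^[n] ⁻¹' B)) = m (T^[n] ⁻¹' B) ↔ m (Q ⁻¹' B) = m B) := by
    intro n
    induction n with
    | zero => intro B _; rfl
    | succ n ih =>
      intro B hB
      rw [Function.iterate_succ, Set.preimage_comp, hpre _ ((T.measurable.iterate n) hB), ih B hB]
  refine ⟨hQ, Measure.ext fun A hA => ?_⟩
  rw [Measure.map_apply hQ hA]
  refine H.sweep_induction (P := fun A => m (Q ⁻¹' A) = m A) ?_ ?_ ?_ ?_ hA
  · intro A B hA hB hAB hP
    have : (Q ⁻¹' A : Set Ω) =ᵐ[m] (Q ⁻¹' B : Set Ω) := hquasi.preimage_ae_eq hAB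
    rw [← measure_congr this, hP, measure_congr hAB]
  · intro f hf hd hP
    rw [Set.preimage_iUnion, measure_iUnion (fun i j hij => (hd hij).preimage Q)
      (fun i => hQ (hf i)), measure_iUnion hd hf]
    exact tsum_congr hP
  · exact fun n A hA hAY => (hpre' n A hA).2 (hbase A hA hAY)
  · intro n A hA hAY
    rw [← hpre' n _ ((T.symm.measurable.iterate n) hA)]
    have e : T^[n] ⁻¹' (T.symm^[n] ⁻¹' A) = A := by
      ext x
      simp [(Function.LeftInverse.iterate T.symm_apply_apply n) x]
    rw [e]
    exact hbase A hA hAY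

end UniformlyVisited

namespace CFData

variable {k : ℕ} {D : CFData k}

/-! ### Points and cylinders of the (C,F)-space -/

/-- Distinct copies of towers are disjoint, so the product `f_n * c_{n+1}` determines `c_{n+1}`, and
then `f_n` by cancellation. -/
theorem Path.embed_injective {n : ℕ} :
    Function.Injective (Path.embed : D.Path n → D.Path (n + 1)) := by
  intro p q h
  have h1 : p.embed.1.1 = q.embed.1.1 := by rw [h]
  have h2 : p.embed.1.2 = q.embed.1.2 := by rw [h]
  have h3 : ∀ m, p.1.2 (m + 1) = q.1.2 (m + 1) := fun m => congrFun h2 m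
  have h4 : p.1.2 0 = q.1.2 0 := by
    by_contra hne
    exact D.mul_disjoint n _ (p.2.2.1 0) _ (q.2.2.1 0) hne _ p.2.1 _ q.2.1 p.2.2.2.1 q.2.2.2.1 h1
  refine Subtype.ext (Prod.ext (Prod.ext ?_ ?_) (funext fun m => ?_))
  · have : p.1.1.1 + (p.1.2 0).2.1 = q.1.1.1 + (q.1.2 0).2.1 := congrArg Prod.fst h1
    rw [h4] at this
    exact add_right_cancel this
  · rw [p.2.2.2.1, q.2.2.2.1, h4]
  · cases m with
    | zero => exact h4
    | succ m => exact h3 m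

theorem Path.pt_embed {n : ℕ} (p : D.Path n) : p.embed.pt = p.pt :=
  (Quot.sound (r := fun a b : (n : ℕ) × D.Path n => b = ⟨a.1 + 1, a.2.embed⟩)
    (a := ⟨n, p⟩) rfl).symm

/-- Identified points have a common image after finitely many embeddings of each. Two points of the
same `X_n` need equally many, and each embedding is injective. -/
theorem Path.pt_injective {n : ℕ} : Function.Injective (Path.pt : D.Path n → D.Space) := by
  set step : ((n : ℕ) × D.Path n) → ((n : ℕ) × D.Path n) := fun a => ⟨a.1 + 1, a.2.embed⟩
  have hinj : Function.Injective step := by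
    rintro ⟨a, p⟩ ⟨b, q⟩ hab
    obtain rfl : a = b := Nat.succ_injective (congrArg Sigma.fst hab)
    have : p = q := Path.embed_injective (eq_of_heq (Sigma.mk.inj hab).2)
    rw [this]
  have hfst : ∀ (d : ℕ) a, (step^[d] a).1 = a.1 + d := by
    intro d
    induction d with
    | zero => intro a; rfl
    | succ d ih =>
      intro a
      rw [Function.iterate_succ_apply, ih]
      change a.1 + 1 + d = _
      omega
  have hjoin : ∀ a b, Relation.EqvGen (fun a b => b = step a) a b →
      ∃ d e : ℕ, step^[d] a = step^[e] b := by
    intro a b hab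
    induction hab with
    | rel a b hab => exact ⟨1, 0, hab.symm⟩
    | refl a => exact ⟨0, 0, rfl⟩
    | symm a b _ ih => obtain ⟨d, e, h⟩ := ih; exact ⟨e, d, h.symm⟩
    | trans a b c _ _ ih1 ih2 =>
      obtain ⟨d, e, h⟩ := ih1
      obtain ⟨d', e', h'⟩ := ih2
      refine ⟨d' + d, e + e', ?_⟩
      rw [Function.iterate_add_apply, h, ← Function.iterate_add_apply, add_comm d',
        Function.iterate_add_apply, h', ← Function.iterate_add_apply]
  intro p q hpq
  obtain ⟨d, e, h⟩ := hjoin _ _ (Quot.eqvGen_exact hpq)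
  have h1 := congrArg Sigma.fst h
  rw [hfst, hfst] at h1
  obtain rfl : d = e := Nat.add_left_cancel h1
  exact eq_of_heq (Sigma.mk.inj (hinj.iterate d h)).2

theorem exists_pt_eq (x : D.Space) : ∃ (n : ℕ) (p : D.Path n), p.pt = x := by
  induction x using Quot.ind with
  | mk a => exact ⟨a.1, a.2, rfl⟩

theorem Path.pt_mem_cyl {n : ℕ} (p : D.Path n) {A : Set (ℤ × Fin k)} :
    p.pt ∈ D.cyl n A ↔ p.head ∈ A :=
  ⟨fun ⟨_, hq, h⟩ => Path.pt_injective h ▸ hq, fun h => ⟨p, h, rfl⟩⟩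

theorem Path.head_mem {n : ℕ} (p : D.Path n) : p.head ∈ D.F n := p.2.1

theorem Path.continuous_head {n : ℕ} : Continuous (Path.head : D.Path n → ℤ × Fin k) :=
  continuous_fst.comp continuous_subtype_val

theorem Path.continuous_embed {n : ℕ} : Continuous (Path.embed : D.Path n → D.Path (n + 1)) := by
  have h2 : ∀ m, Continuous fun p : D.Path n => p.1.2 m := fun m =>
    (continuous_apply m).comp (continuous_snd.comp continuous_subtype_val)
  refine Continuous.subtype_mk (Continuous.prodMk (Continuous.prodMk ?_ ?_)
    (continuous_pi fun m => h2 (m + 1))) _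
  · exact (continuous_fst.comp (continuous_fst.comp continuous_subtype_val)).add
      (continuous_fst.comp (continuous_snd.comp (h2 0)))
  · exact continuous_snd.comp (continuous_snd.comp (h2 0))

variable (D) in
/-- The set `A * C_{n+1}` of levels of the castle `n + 1` contained in the levels from `A` of the
castle `n`. -/
def refine (n : ℕ) (A : Finset (ℤ × Fin k)) : Finset (ℤ × Fin k) :=
  ((A ×ˢ D.C (n + 1)).filter fun a => a.1.2 = a.2.1).image
    fun a => (a.1.1 + a.2.2.1, a.2.2.2)

theorem mem_refine {n : ℕ} {A : Finset (ℤ × Fin k)} {f : ℤ × Fin k} :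
    f ∈ D.refine n A ↔ ∃ a ∈ A, ∃ c ∈ D.C (n + 1), a.2 = c.1 ∧ (a.1 + c.2.1, c.2.2) = f := by
  simp only [refine, Finset.mem_image, Finset.mem_filter, Finset.mem_product, Prod.exists]
  constructor
  · rintro ⟨a, i, c1, c2, c3, ⟨⟨h1, h2⟩, h3⟩, h4⟩
    exact ⟨a, i, h1, c1, c2, c3, h2, h3, h4⟩
  · rintro ⟨a, i, h1, c1, c2, c3, h2, h3, h4⟩
    exact ⟨a, i, c1, c2, c3, ⟨⟨h1, h2⟩, h3⟩, h4⟩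

theorem refine_mono {n : ℕ} {A B : Finset (ℤ × Fin k)} (h : A ⊆ B) :
    D.refine n A ⊆ D.refine n B := by
  intro f hf
  obtain ⟨a, ha, hc⟩ := mem_refine.1 hf
  exact mem_refine.2 ⟨a, h ha, hc⟩

theorem refine_subset {n : ℕ} {A : Finset (ℤ × Fin k)} (h : A ⊆ D.F n) :
    D.refine n A ⊆ D.F (n + 1) := by
  intro f hf
  obtain ⟨a, ha, c, hc, hac, rfl⟩ := mem_refine.1 hf
  exact D.mul_mem_F n a (h ha) c hc hac

/-- A point of `X_{n+1}` lying in a level of the form `f * c` belongs to `X_n`. -/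
theorem Path.exists_embed_eq {n : ℕ} (q : D.Path (n + 1)) {f : ℤ × Fin k} {c : Fin k × ℤ × Fin k}
    (hf : f ∈ D.F n) (hc : c ∈ D.C (n + 1)) (hfc : f.2 = c.1)
    (h : (f.1 + c.2.1, c.2.2) = q.head) :
    ∃ p : D.Path n, p.embed = q ∧ p.head = f ∧ p.1.2 0 = c ∧ ∀ m, p.1.2 (m + 1) = q.1.2 m := by
  refine ⟨⟨(f, fun m => Nat.casesOn m c fun m => q.1.2 m), hf, ?_, hfc, ?_⟩, ?_, rfl, rfl,
    fun _ => rfl⟩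
  · intro m
    cases m with
    | zero => exact hc
    | succ m =>
      have := q.2.2.1 m
      rwa [show n + 1 + (m + 1) = n + 1 + 1 + m by omega]
  · intro m
    cases m with
    | zero => exact (congrArg Prod.snd h).trans q.2.2.2.1
    | succ m => exact q.2.2.2.2 m
  · exact Subtype.ext (Prod.ext h rfl)

theorem cyl_refine {n : ℕ} {A : Finset (ℤ × Fin k)} (hA : A ⊆ D.F n) :
    D.cyl (n + 1) {f | f ∈ D.refine n A} = D.cyl n {f | f ∈ A} := by
  ext x
  constructor
  · rintro ⟨q, hq, rfl⟩
    obtain ⟨a, ha, c, hc, hac, h⟩ := mem_refine.1 hq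
    obtain ⟨p, hp, hpa, -⟩ := q.exists_embed_eq (hA ha) hc hac h
    exact ⟨p, by rw [hpa]; exact ha, by rw [← hp, Path.pt_embed]⟩
  · rintro ⟨p, hp, rfl⟩
    exact ⟨p.embed, mem_refine.2 ⟨_, hp, _, p.2.2.1 0, p.2.2.2.1, rfl⟩, p.pt_embed⟩

variable (D) in
/-- The levels of the castle `m ≥ n` that are contained in the levels from `A` of the castle `n`. -/
def levels (n : ℕ) (A : Finset (ℤ × Fin k)) : ℕ → Finset (ℤ × Fin k)
  | 0 => if n = 0 then A else ∅
  | m + 1 => if n = m + 1 then A else D.refine m (levels n A m)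

theorem levels_self (n : ℕ) (A : Finset (ℤ × Fin k)) : D.levels n A n = A := by
  cases n <;> simp [levels]

theorem levels_succ {n m : ℕ} (h : n ≤ m) (A : Finset (ℤ × Fin k)) :
    D.levels n A (m + 1) = D.refine m (D.levels n A m) := by
  rw [levels, if_neg (by omega)]

theorem levels_subset {n m : ℕ} (h : n ≤ m) {A : Finset (ℤ × Fin k)} (hA : A ⊆ D.F n) :
    D.levels n A m ⊆ D.F m := by
  induction m, h using Nat.le_induction with
  | base => rwa [levels_self]
  | succ m h ih => rw [levels_succ h]; exact refine_subset ih

theorem cyl_levels {n m : ℕ} (h : n ≤ m) {A : Finset (ℤ × Fin k)} (hA : A ⊆ D.F n) :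
    D.cyl m {f | f ∈ D.levels n A m} = D.cyl n {f | f ∈ A} := by
  induction m, h using Nat.le_induction with
  | base => rw [levels_self]
  | succ m h ih => rw [levels_succ h, cyl_refine (levels_subset h hA), ih]

theorem levels_subset_levels {n n' m : ℕ} (hn : n' ≤ n) (h : n ≤ m) {A B : Finset (ℤ × Fin k)}
    (hAB : A ⊆ D.levels n' B n) : D.levels n A m ⊆ D.levels n' B m := by
  induction m, h using Nat.le_induction with
  | base => rwa [levels_self]
  | succ m h ih => rw [levels_succ h, levels_succ (hn.trans h)]; exact refine_mono ih

theorem cyl_inter (n : ℕ) (A B : Set (ℤ × Fin k)) : D.cyl n A ∩ D.cyl n B = D.cyl n (A ∩ B) := by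
  ext x
  constructor
  · rintro ⟨⟨p, hp, rfl⟩, h⟩
    exact ⟨p, ⟨hp, p.pt_mem_cyl.1 h⟩, rfl⟩
  · rintro ⟨p, hp, rfl⟩
    exact ⟨⟨p, hp.1, rfl⟩, ⟨p, hp.2, rfl⟩⟩

/-- Openness has to be checked in every `X_m`. For `m ≥ n` it is a condition on the discrete first
coordinate; for smaller `m` it is pulled back along the continuous embeddings. -/
theorem isOpen_cyl {n : ℕ} {A : Finset (ℤ × Fin k)} (hA : A ⊆ D.F n) :
    IsOpen (D.cyl n {f | f ∈ A}) := by
  have h1 : ∀ m, n ≤ m → IsOpen {p : D.Path m | p.pt ∈ D.cyl n {f | f ∈ A}} := by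
    intro m hm
    rw [← cyl_levels hm hA]
    simp_rw [Path.pt_mem_cyl]
    exact (isOpen_discrete _).preimage Path.continuous_head
  have h2 : ∀ d m, IsOpen {p : D.Path (m + d) | p.pt ∈ D.cyl n {f | f ∈ A}} →
      IsOpen {p : D.Path m | p.pt ∈ D.cyl n {f | f ∈ A}} := by
    intro d
    induction d with
    | zero => exact fun m h => h
    | succ d ih =>
      intro m h
      refine ih m ?_
      have := h.preimage (Path.continuous_embed (D := D) (n := m + d))
      convert this using 1
      ext p
      change p.pt ∈ D.cyl n {f | f ∈ A} ↔ p.embed.pt ∈ D.cyl n {f | f ∈ A}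
      rw [Path.pt_embed]
  have h3 : IsOpen ((Quot.mk _ : ((n : ℕ) × D.Path n) → D.Space) ⁻¹' D.cyl n {f | f ∈ A}) := by
    rw [isOpen_sigma_iff]
    exact fun m => h2 n m (h1 _ (Nat.le_add_left n m))
  exact h3

/-- A single level of a sufficiently late castle determines the head and the first `M` entries, so
one-level cylinders form a base of the topology. The induction passes from `p` to `p.embed`. -/
theorem Path.exists_cyl_subset (M : ℕ) : ∀ {n : ℕ} (p : D.Path n), ∃ (N : ℕ) (f : ℤ × Fin k),
    f ∈ D.F N ∧ p.pt ∈ D.cyl N {a | a ∈ ({f} : Finset _)} ∧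
    ∀ x : D.Space, x ∈ D.cyl N {a | a ∈ ({f} : Finset _)} →
      ∃ q : D.Path n, q.pt = x ∧ q.head = p.head ∧ ∀ i < M, q.1.2 i = p.1.2 i := by
  induction M with
  | zero =>
    intro n p
    refine ⟨n, p.head, p.head_mem, p.pt_mem_cyl.2 (by simp), ?_⟩
    rintro _ ⟨q, hq, rfl⟩
    exact ⟨q, rfl, by simpa using hq, by simp⟩
  | succ M ih =>
    intro n p
    obtain ⟨N, f, hf, hp, hx⟩ := ih p.embed
    rw [Path.pt_embed] at hp
    refine ⟨N, f, hf, hp, fun x hxf => ?_⟩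
    obtain ⟨q, rfl, hq1, hq2⟩ := hx x hxf
    obtain ⟨p', h1, h2, h3, h4⟩ := q.exists_embed_eq p.2.1 (p.2.2.1 0) p.2.2.2.1 hq1.symm
    refine ⟨p', by rw [← h1, Path.pt_embed], h2, fun i hi => ?_⟩
    cases i with
    | zero => exact h3
    | succ i => rw [h4, hq2 i (by omega)]; rfl

variable (D) in
/-- The π-system of all cylinders. -/
def cylinders : Set (Set D.Space) :=
  {s | ∃ (n : ℕ) (A : Finset (ℤ × Fin k)), A ⊆ D.F n ∧ s = D.cyl n {f | f ∈ A}}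

theorem isPiSystem_cylinders : IsPiSystem D.cylinders := by
  rintro _ ⟨n, A, hA, rfl⟩ _ ⟨m, B, hB, rfl⟩ -
  have hn := le_max_left n m
  have hm := le_max_right n m
  refine ⟨max n m, D.levels n A (max n m) ∩ D.levels m B (max n m),
    Finset.inter_subset_left.trans (levels_subset hn hA), ?_⟩
  rw [← cyl_levels hn hA, ← cyl_levels hm hB, cyl_inter]
  congr 1
  ext f
  simp

theorem measurableSet_of_mem_cylinders {s : Set D.Space} (hs : s ∈ D.cylinders) :
    MeasurableSet s := by
  obtain ⟨n, A, hA, rfl⟩ := hs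
  exact (isOpen_cyl hA).measurableSet

theorem exists_cylinder_of_isOpen {U : Set D.Space} (hU : IsOpen U) {x : D.Space} (hx : x ∈ U) :
    ∃ (N : ℕ) (f : ℤ × Fin k), f ∈ D.F N ∧ x ∈ D.cyl N {a | a ∈ ({f} : Finset _)} ∧
      D.cyl N {a | a ∈ ({f} : Finset _)} ⊆ U := by
  obtain ⟨n, p, rfl⟩ := exists_pt_eq x
  have hU' : IsOpen {q : D.Path n | q.pt ∈ U} := by
    have h3 : IsOpen ((Quot.mk _ : ((n : ℕ) × D.Path n) → D.Space) ⁻¹' U) := hU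
    exact isOpen_sigma_iff.1 h3 n
  obtain ⟨V, hV, hVU⟩ := isOpen_induced_iff.1 hU'
  have hpV : p.1 ∈ V := by
    have : p ∈ {q : D.Path n | q.pt ∈ U} := hx
    rwa [← hVU] at this
  obtain ⟨V1, V2, hV1, hV2, hp1, hp2, hV12⟩ := isOpen_prod_iff.1 hV p.1.1 p.1.2 hpV
  obtain ⟨I, u, hu, huV⟩ := isOpen_pi_iff.1 hV2 _ hp2
  obtain ⟨N, f, hf, hpf, hsub⟩ := Path.exists_cyl_subset (I.sup id + 1) p
  refine ⟨N, f, hf, hpf, fun y hy => ?_⟩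
  obtain ⟨q, rfl, hq1, hq2⟩ := hsub y hy
  have : q ∈ {q : D.Path n | q.pt ∈ U} := by
    rw [← hVU]
    refine hV12 (Set.mk_mem_prod ?_ (huV fun i hi => ?_))
    · change q.head ∈ V1
      rw [hq1]
      exact hp1
    · rw [hq2 i (Nat.lt_succ_of_le (Finset.le_sup (f := id) hi))]
      exact (hu i hi).2
  exact this

/-- There are only countably many one-level cylinders, so every open set is a countable union of
them. -/
theorem borel_eq_generateFrom_cylinders :
    borel D.Space = MeasurableSpace.generateFrom D.cylinders := by
  refine le_antisymm ?_ (MeasurableSpace.generateFrom_le fun s hs =>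
    measurableSet_of_mem_cylinders hs)
  refine MeasurableSpace.generateFrom_le fun U hU => ?_
  have : U = ⋃ a : {a : ℕ × ℤ × Fin k // a.2 ∈ D.F a.1 ∧
      D.cyl a.1 {b | b ∈ ({a.2} : Finset _)} ⊆ U}, D.cyl a.1.1 {b | b ∈ ({a.1.2} : Finset _)} := by
    refine subset_antisymm (fun x hx => ?_) (Set.iUnion_subset fun a => a.2.2)
    obtain ⟨N, f, hf, hxf, hsub⟩ := exists_cylinder_of_isOpen hU hx
    exact Set.mem_iUnion.2 ⟨⟨(N, f), hf, hsub⟩, hxf⟩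
  rw [this]
  refine MeasurableSet.iUnion fun a => MeasurableSpace.measurableSet_generateFrom
    ⟨a.1.1, {a.1.2}, by simpa using a.2.1, rfl⟩

/-! ### The action on orbits -/

theorem Path.exists_embedding {n N : ℕ} (h : n ≤ N) (p : D.Path n) : ∃ q : D.Path N, q.pt = p.pt ∧
    ∀ g : ℤ, (g + p.head.1, p.head.2) ∈ D.F n → (g + q.head.1, q.head.2) ∈ D.F N := by
  induction N, h using Nat.le_induction with
  | base => exact ⟨p, rfl, fun _ h => h⟩
  | succ N h ih =>
    obtain ⟨q, hq, hg⟩ := ih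
    refine ⟨q.embed, by rw [Path.pt_embed, hq], fun g hgp => ?_⟩
    have := D.mul_mem_F N _ (hg g hgp) _ (q.2.2.1 0) q.2.2.2.1
    rwa [add_assoc] at this

theorem exists_path_of_mem_domain {x : D.Space} (hx : x ∈ D.domain) (g g' : ℤ) :
    ∃ (n : ℕ) (p : D.Path n), p.pt = x ∧ (g + p.head.1, p.head.2) ∈ D.F n ∧
      (g' + p.head.1, p.head.2) ∈ D.F n := by
  obtain ⟨n, p, hp, hg⟩ := Set.mem_iInter.1 hx g
  obtain ⟨n', p', hp', hg'⟩ := Set.mem_iInter.1 hx g'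
  obtain ⟨q, hq, h⟩ := p.exists_embedding (le_max_left n n')
  obtain ⟨q', hq', h'⟩ := p'.exists_embedding (le_max_right n n')
  have : q = q' := Path.pt_injective (by rw [hq, hq', hp, hp'])
  subst this
  exact ⟨_, q, by rw [hq, hp], h _ hg, h' _ hg'⟩

theorem act_mem_domain {x : D.Space} (hx : x ∈ D.domain) (g : ℤ) : D.act g x ∈ D.domain := by
  refine Set.mem_iInter.2 fun g' => ?_
  obtain ⟨n, p, rfl, hg, hg'⟩ := exists_path_of_mem_domain hx g (g' + g)
  rw [act_pt p hx hg]
  refine ⟨n, p.translate g hg, rfl, ?_⟩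
  rw [add_assoc] at hg'
  exact hg'

theorem act_act {x : D.Space} (hx : x ∈ D.domain) (g g' : ℤ) :
    D.act g' (D.act g x) = D.act (g' + g) x := by
  have hgx := act_mem_domain hx g
  obtain ⟨n, p, rfl, hg, hg'⟩ := exists_path_of_mem_domain hx g (g' + g)
  rw [act_pt p hx hg] at hgx ⊢
  have h : (g' + (p.translate g hg).head.1, (p.translate g hg).head.2) ∈ D.F n := by
    rw [add_assoc] at hg'
    exact hg'
  rw [act_pt _ hgx h, act_pt p hx hg']
  congr 1
  exact Subtype.ext (Prod.ext (Prod.ext (add_assoc g' g p.head.1).symm rfl) rfl)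

theorem act_zero (x : D.Space) : D.act 0 x = x := by
  by_cases hx : x ∈ D.domain
  · obtain ⟨n, p, rfl⟩ := exists_pt_eq x
    have h : ((0 : ℤ) + p.head.1, p.head.2) ∈ D.F n := by rw [zero_add]; exact p.head_mem
    rw [act_pt p hx h]
    congr 1
    exact Subtype.ext (Prod.ext (Prod.ext (zero_add _) rfl) rfl)
  · exact dif_neg hx

theorem act_mem_cyl {x : D.Space} (hx : x ∈ D.domain) {n : ℕ} {f : ℤ × Fin k} {g : ℤ}
    (hxf : x ∈ D.cyl n {f}) (hg : (g + f.1, f.2) ∈ D.F n) :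
    D.act g x ∈ D.cyl n {(g + f.1, f.2)} := by
  obtain ⟨p, rfl, rfl⟩ := hxf
  rw [act_pt p hx hg]
  exact ⟨_, Set.mem_singleton _, rfl⟩

theorem eq_of_mem_cyl {x : D.Space} {n : ℕ} {f f' : ℤ × Fin k} (h : x ∈ D.cyl n {f})
    (h' : x ∈ D.cyl n {f'}) : f = f' := by
  obtain ⟨p, hp, rfl⟩ := h
  have := p.pt_mem_cyl.1 h'
  exact Eq.trans (Eq.symm hp) this

theorem mem_F_of_mem_cyl {x : D.Space} {n : ℕ} {f : ℤ × Fin k} (h : x ∈ D.cyl n {f}) :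
    f ∈ D.F n := by
  obtain ⟨p, rfl, rfl⟩ := h
  exact p.head_mem

end CFData

namespace CFData

variable {k : ℕ} {D : CFData k}

/-! ### Counting levels -/

/-- The number of levels from `A` in the `j`-th tower. -/
def count (A : Finset (ℤ × Fin k)) (j : Fin k) : ℕ := (A.filter fun f => f.2 = j).card

theorem count_mono {A B : Finset (ℤ × Fin k)} (h : A ⊆ B) (j : Fin k) : count A j ≤ count B j :=
  Finset.card_le_card (Finset.filter_subset_filter _ h)

/-- By disjointness of the copies, each level of the refinement comes from exactly one pair of a
level in `A` and a matching copy. -/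
theorem count_refine {n : ℕ} {A : Finset (ℤ × Fin k)} (hA : A ⊆ D.F n) (j : Fin k) :
    count (D.refine n A) j = ∑ q, count A q * D.copies (n + 1) q j := by
  unfold count refine
  rw [Finset.filter_image, Finset.card_image_of_injOn, Finset.card_eq_sum_card_fiberwise
    (f := fun a => a.1.2) (t := Finset.univ) (fun _ _ => Finset.mem_coe.2 (Finset.mem_univ _))]
  · refine Finset.sum_congr rfl fun q _ => ?_
    rw [copies, ← Finset.card_product]
    congr 1
    ext ⟨a, c⟩
    simp only [Finset.mem_filter, Finset.mem_product]
    constructor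
    · rintro ⟨⟨⟨⟨h1, h2⟩, h3⟩, h4⟩, h5⟩
      exact ⟨⟨h1, h5⟩, h2, h3.symm.trans h5, h4⟩
    · rintro ⟨⟨h1, h5⟩, h2, h3, h4⟩
      exact ⟨⟨⟨⟨h1, h2⟩, h5.trans h3.symm⟩, h4⟩, h5⟩
  · rintro ⟨a, c⟩ h ⟨a', c'⟩ h' he
    simp only [Finset.coe_filter, Finset.mem_filter, Finset.mem_product] at h h'
    obtain ⟨⟨⟨ha, hc⟩, hac⟩, -⟩ := h
    obtain ⟨⟨⟨ha', hc'⟩, hac'⟩, -⟩ := h'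
    have hcc : c = c' := by
      by_contra hne
      exact D.mul_disjoint n c hc c' hc' hne a (hA ha) a' (hA ha') hac hac' he
    subst hcc
    have h1 : a.1 + c.2.1 = a'.1 + c.2.1 := congrArg Prod.fst he
    have h2 : a.2 = a'.2 := hac.trans hac'.symm
    rw [Prod.ext (add_right_cancel h1) h2]

theorem sum_copies (D : CFData k) (n : ℕ) (i : Fin k) : 2 ≤ ∑ j, D.copies (n + 1) i j := by
  have h := D.one_lt_card_C n i
  rw [Finset.card_eq_sum_card_fiberwise (f := fun c => c.2.2) (t := Finset.univ)
    (fun _ _ => Finset.mem_coe.2 (Finset.mem_univ _))] at h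
  simp_rw [Finset.filter_filter] at h
  exact h

theorem minHeight_le (D : CFData k) (n : ℕ) (j : Fin k) : D.minHeight n ≤ D.height n j :=
  ciInf_le (OrderBot.bddBelow _) j

theorem exists_minHeight_eq [Nonempty (Fin k)] (D : CFData k) (n : ℕ) :
    ∃ j, D.height n j = D.minHeight n := by
  obtain ⟨j, hj⟩ := exists_eq_ciInf_of_finite (f := fun i => D.height n i)
  exact ⟨j, hj⟩

variable (D) in
/-- The levels of the castle `n` that are contained in `X_0`. -/
def baseLevels (n : ℕ) : Finset (ℤ × Fin k) := D.levels 0 (D.F 0) n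

theorem baseLevels_subset (n : ℕ) : D.baseLevels n ⊆ D.F n :=
  levels_subset (Nat.zero_le n) subset_rfl

theorem cyl_baseLevels (n : ℕ) : D.cyl n {f | f ∈ D.baseLevels n} = D.base :=
  cyl_levels (Nat.zero_le n) subset_rfl

/-! ### Measures of levels and asymptotic proportions in balanced constructions. -/

section Measure

variable {lam : ℕ → Fin k → ℝ≥0} {μ : Measure D.Space}

theorem IsCFMeasure.measureReal_cyl (H : D.IsCFMeasure lam μ) {n : ℕ} {A : Finset (ℤ × Fin k)}
    (hA : A ⊆ D.F n) : μ.real (D.cyl n {f | f ∈ A}) = ∑ j, (count A j : ℝ) * lam n j := by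
  rw [measureReal_def, H n A hA, ENNReal.toReal_sum fun i _ =>
    ENNReal.mul_ne_top (ENNReal.natCast_ne_top _) ENNReal.coe_ne_top]
  refine Finset.sum_congr rfl fun j _ => ?_
  rw [ENNReal.toReal_mul]
  rfl

/-- The base of the `i`-th tower is measured once in the castle `n` and once as the union of its
copies in the castle `n + 1`. -/
theorem IsCFMeasure.lam_eq (H : D.IsCFMeasure lam μ) (n : ℕ) (i : Fin k) :
    (lam n i : ℝ) = ∑ j, (D.copies (n + 1) i j : ℝ) * lam (n + 1) j := by
  have hA : ({((0 : ℤ), i)} : Finset (ℤ × Fin k)) ⊆ D.F n := by simpa using D.zero_mem_F n i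
  have hc : ∀ q, count ({((0 : ℤ), i)} : Finset (ℤ × Fin k)) q = if q = i then 1 else 0 := by
    intro q
    unfold count
    rw [Finset.filter_singleton]
    by_cases h : i = q
    · subst h; simp
    · rw [if_neg h, if_neg (Ne.symm h)]; rfl
  have h1 := H.measureReal_cyl hA
  have h2 := H.measureReal_cyl (refine_subset hA)
  rw [cyl_refine hA, h1] at h2
  simp_rw [count_refine hA, hc] at h2
  simpa using h2

/-- Every level is cut into at least two pieces at each stage. -/
theorem IsCFMeasure.pow_mul_le_lam (H : D.IsCFMeasure lam μ) {s : ℝ} (n p : ℕ)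
    (h : ∀ j, s ≤ lam (n + p) j) (hs : 0 ≤ s) (i : Fin k) : 2 ^ p * s ≤ lam n i := by
  induction p generalizing n i with
  | zero => simpa using h i
  | succ p ih =>
    have ih' : ∀ j, 2 ^ p * s ≤ lam (n + 1) j := fun j =>
      ih (n + 1) (by rwa [show n + 1 + p = n + (p + 1) by omega]) j
    rw [H.lam_eq]
    have h2 : (2 : ℝ) ≤ ∑ j, (D.copies (n + 1) i j : ℝ) := by exact_mod_cast D.sum_copies n i
    calc (2 : ℝ) ^ (p + 1) * s = 2 * (2 ^ p * s) := by ring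
      _ ≤ (∑ j, (D.copies (n + 1) i j : ℝ)) * (2 ^ p * s) := by gcongr
      _ = ∑ j, (D.copies (n + 1) i j : ℝ) * (2 ^ p * s) := Finset.sum_mul _ _ _
      _ ≤ _ := Finset.sum_le_sum fun j _ => by gcongr; exact ih' j

/-- The measure of the union of the bases of the towers of the castle `n`. -/
noncomputable def width (lam : ℕ → Fin k → ℝ≥0) (n : ℕ) : ℝ := ∑ j, (lam n j : ℝ)

theorem lam_le_width (lam : ℕ → Fin k → ℝ≥0) (n : ℕ) (j : Fin k) : (lam n j : ℝ) ≤ width lam n :=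
  Finset.single_le_sum (f := fun j => (lam n j : ℝ)) (fun _ _ => NNReal.coe_nonneg _)
    (Finset.mem_univ j)

namespace IsBalanced

variable (H : D.IsBalanced lam μ)

include H

theorem nonempty_fin : Nonempty (Fin k) := by
  by_contra h
  rw [not_nonempty_iff] at h
  obtain ⟨δ, -, h1, -⟩ := H.exists_delta
  simp at h1

theorem measureReal_base : μ.real (D.cyl 0 {f | f ∈ D.F 0}) = 1 := by
  have h : μ (D.cyl 0 {f | f ∈ D.F 0}) = 1 := H.measure_base
  rw [measureReal_def, h, ENNReal.toReal_one]

theorem exists_lam_ge :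
    ∃ c > 0, ∀ᶠ n in atTop, 0 < width lam n ∧ ∀ j, c * width lam n ≤ lam n j := by
  have := H.nonempty_fin
  obtain ⟨Λ, hΛ, -, hlim, -⟩ := H.exists_Lambda
  obtain ⟨j0, hj0⟩ := exists_eq_ciInf_of_finite (f := Λ)
  have hle : ∀ j, Λ j0 ≤ Λ j := fun j => hj0 ▸ ciInf_le (Set.finite_range Λ).bddBelow j
  refine ⟨Λ j0 / 2, half_pos (hΛ j0), ?_⟩
  have h1 : ∀ᶠ n in atTop, ∀ j, Λ j0 / 2 < (lam n j : ℝ) / width lam n := by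
    rw [eventually_all]
    intro j
    exact (hlim j).eventually_const_lt ((half_lt_self (hΛ j0)).trans_le (hle j))
  filter_upwards [h1] with n hn
  have hpos : 0 < width lam n := by
    refine lt_of_le_of_ne (Finset.sum_nonneg fun _ _ => NNReal.coe_nonneg _) fun h => ?_
    have := hn j0
    rw [← h, div_zero] at this
    linarith [hΛ j0]
  exact ⟨hpos, fun j => ((lt_div_iff₀ hpos).1 (hn j)).le⟩

/-- The count in tower `j` of the castle `m + 1` is the sum over `q` of the counts at stage `m`,
weighted by the copies of tower `q` in tower `j`. Normalized, these weights and the measures of the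
bases share the limit `Λ`. Replacing one by the other turns the sum into the measure of the
cylinder, whatever `j` is. -/
theorem tendsto_count_mul {n : ℕ} {A : Finset (ℤ × Fin k)} (hA : A ⊆ D.F n) (j : Fin k) :
    Tendsto (fun m => (count (D.levels n A (m + 1)) j : ℝ) *
      (width lam m / ∑ l, (D.copies (m + 1) l j : ℝ))) atTop
      (𝓝 (μ.real (D.cyl n {f | f ∈ A}))) := by
  obtain ⟨c, hc, hev⟩ := H.exists_lam_ge
  obtain ⟨Λ, hΛ, -, hlim, hcop⟩ := H.exists_Lambda
  set β := μ.real (D.cyl n {f | f ∈ A}) with hβ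
  have hmeas : ∀ m, n ≤ m → ∑ q, (count (D.levels n A m) q : ℝ) * lam m q = β := by
    intro m hm
    rw [← H.isCFMeasure.measureReal_cyl (levels_subset hm hA), cyl_levels hm hA]
  -- The replacement error vanishes because its coefficients `count * width` stay below `β / c`:
  -- positivity of `Λ` gives `c * width ≤ lam`, and `count * lam ≤ β`.
  have hdiff : Tendsto (fun m => ∑ q, (count (D.levels n A m) q : ℝ) * width lam m *
      ((D.copies (m + 1) q j : ℝ) / ∑ l, (D.copies (m + 1) l j : ℝ) - lam m q / width lam m))
      atTop (𝓝 0) := by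
    rw [← Finset.sum_const_zero (s := (Finset.univ : Finset (Fin k)))]
    refine tendsto_finsetSum _ fun q _ => ?_
    have h0 : Tendsto (fun m => (D.copies (m + 1) q j : ℝ) / ∑ l, (D.copies (m + 1) l j : ℝ)
        - lam m q / width lam m) atTop (𝓝 0) := by
      have := ((tendsto_add_atTop_iff_nat 1).2 (hcop q j)).sub (hlim q)
      rwa [sub_self] at this
    refine squeeze_zero_norm' ?_ (a := fun m => β / c * ‖(D.copies (m + 1) q j : ℝ) /
      ∑ l, (D.copies (m + 1) l j : ℝ) - lam m q / width lam m‖)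
      (by simpa using h0.norm.const_mul (β / c))
    filter_upwards [hev, eventually_ge_atTop n] with m ⟨hpos, hm⟩ hnm
    rw [norm_mul, norm_mul, Real.norm_of_nonneg hpos.le, Real.norm_of_nonneg (Nat.cast_nonneg _)]
    gcongr
    rw [le_div_iff₀ hc]
    calc (count (D.levels n A m) q : ℝ) * width lam m * c
        = (count (D.levels n A m) q : ℝ) * (c * width lam m) := by ring
      _ ≤ (count (D.levels n A m) q : ℝ) * lam m q := by gcongr; exact hm q
      _ ≤ β := by
        rw [← hmeas m hnm]
        exact Finset.single_le_sum (f := fun q => (count (D.levels n A m) q : ℝ) * lam m q)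
          (fun _ _ => by positivity) (Finset.mem_univ q)
  have := hdiff.add_const β
  rw [zero_add] at this
  refine this.congr' ?_
  filter_upwards [hev, eventually_ge_atTop n] with m ⟨hpos, hm⟩ hnm
  rw [← hmeas m hnm, ← Finset.sum_add_distrib, levels_succ hnm, count_refine (levels_subset hnm hA)]
  push_cast
  rw [Finset.sum_mul]
  refine Finset.sum_congr rfl fun q _ => ?_
  field_simp
  ring

/-- The proportion of the levels from `A` among the levels contained in `X_0` is asymptotically
the same in all towers. -/
theorem tendsto_count_div {n : ℕ} {A : Finset (ℤ × Fin k)} (hA : A ⊆ D.F n) (j : Fin k) :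
    Tendsto (fun m => (count (D.levels n A m) j : ℝ) / count (D.baseLevels m) j) atTop
      (𝓝 (μ.real (D.cyl n {f | f ∈ A}))) := by
  have h1 := H.tendsto_count_mul hA j
  -- Dividing by the case of `X_0`, of measure 1, cancels the scaling factor.
  have h2 := H.tendsto_count_mul (n := 0) subset_rfl j
  rw [H.measureReal_base] at h2
  rw [← tendsto_add_atTop_iff_nat 1]
  have := h1.div h2 one_ne_zero
  rw [div_one] at this
  refine this.congr' ?_
  filter_upwards [h2.eventually_ne one_ne_zero] with m hm
  exact mul_div_mul_right _ _ (right_ne_zero_of_mul hm)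

theorem eventually_abs_count_sub_le {n : ℕ} {A : Finset (ℤ × Fin k)} (hA : A ⊆ D.F n) {ε : ℝ}
    (hε : 0 < ε) : ∀ᶠ m in atTop, ∀ j, |(count (D.levels n A m) j : ℝ) -
      μ.real (D.cyl n {f | f ∈ A}) * count (D.baseLevels m) j| ≤ ε * count (D.baseLevels m) j := by
  rw [eventually_all]
  intro j
  -- The count for `X_0` divided by itself tends to 1; since `0 / 0 = 0`, it is eventually nonzero.
  have h2 := H.tendsto_count_div (n := 0) subset_rfl j
  rw [H.measureReal_base] at h2
  filter_upwards [(Metric.tendsto_nhds.1 (H.tendsto_count_div hA j)) ε hε,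
    h2.eventually_ne one_ne_zero] with m hm h0
  have hpos : (0 : ℝ) < count (D.baseLevels m) j :=
    lt_of_le_of_ne (Nat.cast_nonneg _) fun h => by rw [← h, div_zero] at h0; exact h0 rfl
  rw [Real.dist_eq, div_sub' hpos.ne', mul_comm (count (D.baseLevels m) j : ℝ),
    abs_div, abs_of_pos hpos, div_lt_iff₀ hpos] at hm
  exact hm.le

theorem measureReal_base_inter (m : ℕ) (j : Fin k) :
    μ.real (D.base ∩ D.cyl m {f | f ∈ D.F m ∧ f.2 = j}) = count (D.baseLevels m) j * lam m j := by
  have e : D.base ∩ D.cyl m {f | f ∈ D.F m ∧ f.2 = j} =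
      D.cyl m {f | f ∈ (D.baseLevels m).filter fun f => f.2 = j} := by
    rw [← cyl_baseLevels m, cyl_inter]
    congr 1
    ext f
    simp only [Set.mem_inter_iff, Set.mem_ofPred_eq, Finset.mem_filter]
    exact ⟨fun h => ⟨h.1, h.2.2⟩, fun h => ⟨h.1, baseLevels_subset m h.1, h.2⟩⟩
  rw [e, H.isCFMeasure.measureReal_cyl ((Finset.filter_subset _ _).trans (baseLevels_subset m)),
    Finset.sum_eq_single j]
  · unfold count
    rw [Finset.filter_filter]
    simp
  · intro q _ hq
    unfold count
    rw [Finset.filter_filter, Finset.filter_false_of_mem]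
    · simp
    · rintro f - ⟨h1, h2⟩
      exact hq (h2.symm.trans h1)
  · simp

/-- The part of `X_0` in tower `j` has measure `count * lam`, which tends to `δ j > 0`, and `lam` is
comparable to `width`. So each tower has of the order of `1 / width` levels in `X_0`. -/
theorem exists_count_bounds : ∃ c > 0, ∃ C > 0, ∀ᶠ m in atTop, 0 < width lam m ∧ ∀ j,
    c ≤ count (D.baseLevels m) j * width lam m ∧ count (D.baseLevels m) j * width lam m ≤ C ∧
    c ≤ count (D.baseLevels m) j * lam m j := by
  have := H.nonempty_fin
  obtain ⟨c, hc, hev⟩ := H.exists_lam_ge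
  obtain ⟨δ, hδ, -, hlim⟩ := H.exists_delta
  obtain ⟨j0, hj0⟩ := exists_eq_ciInf_of_finite (f := δ)
  obtain ⟨j1, hj1⟩ := exists_eq_ciSup_of_finite (f := δ)
  have hle : ∀ j, δ j0 ≤ δ j := fun j => hj0 ▸ ciInf_le (Set.finite_range δ).bddBelow j
  have hge : ∀ j, δ j ≤ δ j1 := fun j => hj1 ▸ le_ciSup (Set.finite_range δ).bddAbove j
  have h1 : ∀ᶠ m in atTop, ∀ j, δ j0 / 2 < count (D.baseLevels m) j * (lam m j : ℝ) ∧
      count (D.baseLevels m) j * (lam m j : ℝ) < δ j1 + 1 := by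
    rw [eventually_all]
    intro j
    simp_rw [← H.measureReal_base_inter]
    exact ((hlim j).eventually_const_lt ((half_lt_self (hδ j0)).trans_le (hle j))).and
      ((hlim j).eventually_lt_const ((hge j).trans_lt (lt_add_one _)))
  refine ⟨δ j0 / 2, half_pos (hδ j0), (δ j1 + 1) / c, div_pos (by linarith [hδ j1]) hc, ?_⟩
  filter_upwards [h1, hev] with m hm ⟨hpos, hl⟩
  refine ⟨hpos, fun j => ⟨(hm j).1.le.trans ?_, ?_, (hm j).1.le⟩⟩
  · gcongr
    exact lam_le_width lam m j
  · rw [le_div_iff₀ hc]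
    refine le_trans ?_ (hm j).2.le
    rw [mul_assoc, mul_comm _ c]
    gcongr
    exact hl j

theorem exists_pow_mul_width_le : ∃ c > 0, ∀ᶠ m in atTop, ∀ p, 2 ^ p * (c * width lam (m + p)) ≤
    width lam m := by
  obtain ⟨i⟩ := H.nonempty_fin
  obtain ⟨c, hc, hev⟩ := H.exists_lam_ge
  obtain ⟨N, hN⟩ := eventually_atTop.1 hev
  refine ⟨c, hc, ?_⟩
  filter_upwards [eventually_ge_atTop N] with m hm p
  obtain ⟨hpos, h⟩ := hN (m + p) (by omega)
  exact (H.isCFMeasure.pow_mul_le_lam m p h (by positivity) i).trans (lam_le_width lam m i)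

theorem tendsto_width_inv : Tendsto (fun m => (width lam m)⁻¹) atTop atTop := by
  obtain ⟨c, hc, hev⟩ := H.exists_pow_mul_width_le
  obtain ⟨_, -, hev'⟩ := H.exists_lam_ge
  obtain ⟨N, hN, hN'⟩ := (hev.and (hev'.mono fun _ h => h.1)).exists
  obtain ⟨M, hM⟩ := eventually_atTop.1 hev'
  rw [← tendsto_add_atTop_iff_nat N]
  have hlim : Tendsto (fun p : ℕ => c / width lam N * 2 ^ p) atTop atTop :=
    (tendsto_pow_atTop_atTop_of_one_lt one_lt_two).const_mul_atTop (div_pos hc hN')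
  refine tendsto_atTop_mono' _ ?_ hlim
  filter_upwards [eventually_ge_atTop M] with p hp
  have h1 := hN p
  have h2 := (hM (p + N) (by omega)).1
  rw [add_comm N p] at h1
  rw [← one_div, div_mul_eq_mul_div, div_le_div_iff₀ hN' h2]
  linarith

theorem tendsto_minHeight : Tendsto D.minHeight atTop atTop := by
  have := H.nonempty_fin
  obtain ⟨c, hc, C, hC, hev⟩ := H.exists_count_bounds
  rw [← tendsto_natCast_atTop_iff (R := ℝ)]
  refine tendsto_atTop_mono' _ ?_ (H.tendsto_width_inv.const_mul_atTop hc)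
  filter_upwards [hev] with m ⟨hpos, hm⟩
  obtain ⟨j, hj⟩ := D.exists_minHeight_eq m
  rw [← div_eq_mul_inv, div_le_iff₀ hpos, ← hj]
  refine (hm j).1.trans ?_
  gcongr
  exact count_mono (baseLevels_subset m) j

end IsBalanced

end Measure

end CFData

namespace CFData

variable {k : ℕ} {D : CFData k}

/-! ### Counting visits along orbits -/

theorem mem_F_iff {n : ℕ} {f : ℤ × Fin k} : f ∈ D.F n ↔ 0 ≤ f.1 ∧ f.1 < D.height n f.2 :=
  D.interval n f.2 f.1

/-- The number of levels from `L` below the level `f` in the same tower. -/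
def countBelow (L : Finset (ℤ × Fin k)) (f : ℤ × Fin k) : ℕ :=
  (L.filter fun a => a.2 = f.2 ∧ a.1 < f.1).card

theorem countBelow_le (L : Finset (ℤ × Fin k)) (f : ℤ × Fin k) : countBelow L f ≤ count L f.2 :=
  Finset.card_le_card (Finset.monotone_filter_right _ fun _ _ h => h.1)

theorem countBelow_add_one (L : Finset (ℤ × Fin k)) (f : ℤ × Fin k) :
    countBelow L (1 + f.1, f.2) = countBelow L f + if f ∈ L then 1 else 0 := by
  unfold countBelow
  have e : (L.filter fun a => a.2 = f.2 ∧ a.1 < 1 + f.1) =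
      (L.filter fun a => a.2 = f.2 ∧ a.1 < f.1) ∪ L.filter fun a => a = f := by
    ext ⟨a, i⟩
    obtain ⟨b, j⟩ := f
    simp only [Finset.mem_union, Finset.mem_filter, Prod.mk.injEq, ← and_or_left]
    refine and_congr_right fun _ => ?_
    constructor
    · rintro ⟨h1, h2⟩
      rcases lt_or_eq_of_le (show a ≤ b by omega) with h | h
      · exact Or.inl ⟨h1, h⟩
      · exact Or.inr ⟨h, h1⟩
    · rintro (⟨h1, h2⟩ | ⟨h1, h2⟩)
      · exact ⟨h1, by omega⟩
      · exact ⟨h2, by omega⟩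
  rw [e, Finset.card_union_of_disjoint]
  · congr 1
    rw [Finset.filter_eq']
    split_ifs <;> rfl
  · rw [Finset.disjoint_filter]
    rintro a - h rfl
    exact lt_irrefl _ h.2

theorem countBelow_eq_zero {n : ℕ} {L : Finset (ℤ × Fin k)} (hL : L ⊆ D.F n) {f : ℤ × Fin k}
    (hf : f.1 ≤ 0) : countBelow L f = 0 := by
  unfold countBelow
  rw [Finset.card_eq_zero, Finset.filter_eq_empty_iff]
  rintro a ha ⟨-, h⟩
  have := (mem_F_iff.1 (hL ha)).1
  omega

theorem countBelow_eq_count {n : ℕ} {L : Finset (ℤ × Fin k)} (hL : L ⊆ D.F n) {f : ℤ × Fin k}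
    (hf : (D.height n f.2 : ℤ) ≤ f.1) : countBelow L f = count L f.2 := by
  unfold countBelow count
  congr 1
  refine Finset.filter_congr fun a ha => ⟨fun h => h.1, fun h => ⟨h, ?_⟩⟩
  have := (mem_F_iff.1 (hL ha)).2
  rw [h] at this
  omega

variable (D) in
open Classical in
/-- The function on the (C,F)-space with value `g f` on the level `f` of the castle `n`, and `0`
outside `X_n`. -/
noncomputable def lift (n : ℕ) (g : ℤ × Fin k → ℝ) (x : D.Space) : ℝ :=
  if h : ∃ f, x ∈ D.cyl n {f} then g h.choose else 0

theorem lift_of_mem {n : ℕ} (g : ℤ × Fin k → ℝ) {x : D.Space} {f : ℤ × Fin k}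
    (h : x ∈ D.cyl n {f}) : D.lift n g x = g f := by
  have h' : ∃ f, x ∈ D.cyl n {f} := ⟨f, h⟩
  rw [lift, dif_pos h', eq_of_mem_cyl h'.choose_spec h]

theorem lift_of_notMem {n : ℕ} (g : ℤ × Fin k → ℝ) {x : D.Space}
    (h : ¬ ∃ f, x ∈ D.cyl n {f}) : D.lift n g x = 0 := dif_neg h

theorem lift_induction {P : ℝ → Prop} {n : ℕ} {g : ℤ × Fin k → ℝ} (h0 : P 0) (h : ∀ f, P (g f))
    (x : D.Space) : P (D.lift n g x) := by
  unfold lift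
  split_ifs
  · exact h _
  · exact h0

theorem mem_cyl_iff {n : ℕ} {A : Set (ℤ × Fin k)} {x : D.Space} :
    x ∈ D.cyl n A ↔ ∃ f ∈ A, x ∈ D.cyl n {f} :=
  ⟨fun ⟨p, hp, h⟩ => ⟨_, hp, p, rfl, h⟩, fun ⟨_, hf, p, hp, h⟩ => ⟨p, hp ▸ hf, h⟩⟩

theorem act_neg_mem_cyl {x : D.Space} (hx : x ∈ D.domain) {g : ℤ} {n : ℕ} {f : ℤ × Fin k}
    (h : D.act g x ∈ D.cyl n {f}) (hg : 0 ≤ g) (hgf : g ≤ f.1) : x ∈ D.cyl n {(f.1 - g, f.2)} := by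
  have hf := mem_F_iff.1 (mem_F_of_mem_cyl h)
  have := act_mem_cyl (act_mem_domain hx g) (g := -g) h (mem_F_iff.2 ⟨by
    change 0 ≤ -g + f.1
    omega, by
    change -g + f.1 < D.height n f.2
    omega⟩)
  rwa [act_act hx, neg_add_cancel, act_zero, neg_add_eq_sub] at this

variable (D) in
/-- The number of levels from `L` below a point in its tower. -/
noncomputable def below (n : ℕ) (L : Finset (ℤ × Fin k)) : D.Space → ℝ :=
  D.lift n fun f => countBelow L f

variable (D) in
/-- The number of levels from `L` in the tower of a point, if the point is at the top of the
tower. -/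
noncomputable def top (n : ℕ) (L : Finset (ℤ × Fin k)) : D.Space → ℝ :=
  D.lift n fun f => if f.1 + 1 = D.height n f.2 then count L f.2 else 0

theorem below_nonneg (n : ℕ) (L : Finset (ℤ × Fin k)) (x : D.Space) : 0 ≤ D.below n L x :=
  lift_induction (P := fun r => 0 ≤ r) le_rfl (fun _ => Nat.cast_nonneg _) x

theorem top_nonneg (n : ℕ) (L : Finset (ℤ × Fin k)) (x : D.Space) : 0 ≤ D.top n L x := by
  refine lift_induction (P := fun r => 0 ≤ r) le_rfl (fun f => ?_) x
  split_ifs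
  · exact Nat.cast_nonneg _
  · exact le_rfl

theorem below_le {n : ℕ} {L : Finset (ℤ × Fin k)} {W : ℝ} (hW : ∀ j, (count L j : ℝ) ≤ W)
    (hW0 : 0 ≤ W) (x : D.Space) : D.below n L x ≤ W :=
  lift_induction (P := fun r => r ≤ W) hW0
    (fun f => le_trans (by exact_mod_cast countBelow_le L f) (hW f.2)) x

/-- The successor of a top point, or of a point outside `X_n`, is at the bottom of a tower or
outside `X_n`. At a higher level, the point itself would lie one level below it, hence not at a top.
-/
theorem below_act_one_eq_zero {n : ℕ} {L : Finset (ℤ × Fin k)} (hL : L ⊆ D.F n) {x : D.Space}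
    (hx : x ∈ D.domain) (h : ∀ f, x ∈ D.cyl n {f} → f.1 + 1 = D.height n f.2) :
    D.below n L (D.act 1 x) = 0 := by
  by_cases h1 : ∃ f, D.act 1 x ∈ D.cyl n {f}
  · obtain ⟨f, hf⟩ := h1
    rw [below, lift_of_mem _ hf]
    have hF := mem_F_iff.1 (mem_F_of_mem_cyl hf)
    have : f.1 ≤ 0 := by
      by_contra! hpos
      have := h _ (act_neg_mem_cyl hx hf zero_le_one hpos)
      simp only at this
      omega
    exact_mod_cast countBelow_eq_zero hL this
  · exact lift_of_notMem _ h1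

/-- The indicator function of a union of levels is, up to a coboundary, concentrated on the tops
of the towers. -/
theorem indicator_add_below {n : ℕ} {L : Finset (ℤ × Fin k)} (hL : L ⊆ D.F n) {x : D.Space}
    (hx : x ∈ D.domain) :
    (D.cyl n {f | f ∈ L}).indicator (1 : D.Space → ℝ) x + D.below n L x =
      D.below n L (D.act 1 x) + D.top n L x := by
  by_cases h1 : ∃ f, x ∈ D.cyl n {f}
  · obtain ⟨f, hf⟩ := h1
    have hmem : x ∈ D.cyl n {f | f ∈ L} ↔ f ∈ L := by
      rw [mem_cyl_iff]
      constructor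
      · rintro ⟨a, ha, hxa⟩
        rw [eq_of_mem_cyl hf hxa]
        exact ha
      · exact fun h => ⟨f, h, hf⟩
    have hind : (D.cyl n {f | f ∈ L}).indicator (1 : D.Space → ℝ) x + D.below n L x =
        countBelow L (1 + f.1, f.2) := by
      rw [countBelow_add_one, below, lift_of_mem _ hf]
      by_cases hfL : f ∈ L
      · rw [Set.indicator_of_mem (hmem.2 hfL), if_pos hfL]
        push_cast
        rw [add_comm, Pi.one_apply]
      · rw [Set.indicator_of_notMem (mt hmem.1 hfL), if_neg hfL]
        push_cast
        rw [add_comm]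
    rw [hind, top, lift_of_mem _ hf]
    have hF := mem_F_iff.1 (mem_F_of_mem_cyl hf)
    by_cases htop : f.1 + 1 = D.height n f.2
    · rw [if_pos htop, below_act_one_eq_zero hL hx fun a ha => eq_of_mem_cyl hf ha ▸ htop, zero_add,
        countBelow_eq_count hL]
      rw [add_comm, htop]
    · rw [if_neg htop, add_zero, below, lift_of_mem _ (act_mem_cyl hx hf (mem_F_iff.2 ⟨by
        change 0 ≤ 1 + f.1
        omega, by
        change 1 + f.1 < D.height n f.2
        omega⟩))]
  · rw [Set.indicator_of_notMem fun h => h1 ?_, below_act_one_eq_zero hL hx fun f hf =>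
      absurd ⟨f, hf⟩ h1, below, top, lift_of_notMem _ h1, lift_of_notMem _ h1]
    obtain ⟨f, -, hf⟩ := mem_cyl_iff.1 h
    exact ⟨f, hf⟩

variable (D) in
/-- The number of visits to `B` among the points `T_j x` with `j < h`. -/
noncomputable def orbitVisits (B : Set D.Space) (h : ℕ) (x : D.Space) : ℝ :=
  ∑ j ∈ Finset.range h, B.indicator 1 (D.act j x)

variable (D) in
/-- The sum of the values of `top n L` at the points `T_j x` with `j < h`. -/
noncomputable def topSum (n : ℕ) (L : Finset (ℤ × Fin k)) (h : ℕ) (x : D.Space) : ℝ :=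
  ∑ j ∈ Finset.range h, D.top n L (D.act j x)

/-- The coboundary telescopes: visits are counted by complete towers, credited at their tops, up to
the two ends of the orbit segment. -/
theorem orbitVisits_eq {n : ℕ} {L : Finset (ℤ × Fin k)} (hL : L ⊆ D.F n) {x : D.Space}
    (hx : x ∈ D.domain) (h : ℕ) : D.orbitVisits (D.cyl n {f | f ∈ L}) h x =
      D.below n L (D.act h x) - D.below n L x + D.topSum n L h x := by
  have h0 : D.below n L x = D.below n L (D.act (0 : ℕ) x) := by
    rw [Nat.cast_zero, act_zero]
  rw [h0, ← Finset.sum_range_sub (fun j : ℕ => D.below n L (D.act j x)), topSum,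
    ← Finset.sum_add_distrib]
  refine Finset.sum_congr rfl fun j _ => ?_
  have := indicator_add_below hL (act_mem_domain hx j)
  rw [act_act hx, add_comm (1 : ℤ)] at this
  push_cast
  linarith

theorem topSum_nonneg (n : ℕ) (L : Finset (ℤ × Fin k)) (h : ℕ) (x : D.Space) :
    0 ≤ D.topSum n L h x :=
  Finset.sum_nonneg fun _ _ => top_nonneg _ _ _

/-- If `M ⊆ L` has about the proportion `β` of the levels from `L` in each tower, then it has
about the proportion `β` of the visits to `L`, during any stretch of time. -/
theorem abs_orbitVisits_sub_le {n : ℕ} {L M : Finset (ℤ × Fin k)} (hL : L ⊆ D.F n) (hML : M ⊆ L)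
    {β ε W : ℝ} (hβ : 0 ≤ β) (hβ1 : β ≤ 1) (hε : 0 ≤ ε) (hW0 : 0 ≤ W)
    (hW : ∀ j, (count L j : ℝ) ≤ W)
    (hM : ∀ j, |(count M j : ℝ) - β * count L j| ≤ ε * count L j) {x : D.Space}
    (hx : x ∈ D.domain) (h : ℕ) :
    |D.orbitVisits (D.cyl n {f | f ∈ M}) h x - β * D.orbitVisits (D.cyl n {f | f ∈ L}) h x| ≤
      ε * D.orbitVisits (D.cyl n {f | f ∈ L}) h x + (2 + ε) * W := by
  have hWM : ∀ j, (count M j : ℝ) ≤ W := fun j =>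
    le_trans (by exact_mod_cast count_mono hML j) (hW j)
  have htop : ∀ y, |D.top n M y - β * D.top n L y| ≤ ε * D.top n L y := by
    intro y
    by_cases h1 : ∃ f, y ∈ D.cyl n {f}
    · obtain ⟨f, hf⟩ := h1
      rw [top, top, lift_of_mem _ hf, lift_of_mem _ hf]
      split_ifs
      · exact hM _
      · simp
    · rw [top, top, lift_of_notMem _ h1, lift_of_notMem _ h1]
      simp
  have hsum : |D.topSum n M h x - β * D.topSum n L h x| ≤ ε * D.topSum n L h x := by
    unfold topSum
    rw [Finset.mul_sum, Finset.mul_sum, ← Finset.sum_sub_distrib]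
    exact (Finset.abs_sum_le_sum_abs _ _).trans (Finset.sum_le_sum fun j _ => htop _)
  rw [orbitVisits_eq (hML.trans hL) hx, orbitVisits_eq hL hx]
  have b1 := below_nonneg n M x
  have b2 := below_nonneg n M (D.act h x)
  have b3 := below_nonneg n L x
  have b4 := below_nonneg n L (D.act h x)
  have b5 := below_le (n := n) hWM hW0 x
  have b6 := below_le (n := n) hWM hW0 (D.act h x)
  have b7 := below_le (n := n) hW hW0 x
  have b8 := below_le (n := n) hW hW0 (D.act h x)
  have c1 : β * D.below n L x ≤ W := by nlinarith
  have c2 : β * D.below n L (D.act h x) ≤ W := by nlinarith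
  have c3 : 0 ≤ β * D.below n L x := by positivity
  have c4 : 0 ≤ β * D.below n L (D.act h x) := by positivity
  have c5 : ε * D.below n L x ≤ ε * W := by gcongr
  have c6 : 0 ≤ ε * D.below n L (D.act h x) := by positivity
  -- The boundary terms for `M` and `L` cost at most `W` each, and replacing `topSum` by the visits
  -- to `L` costs `ε * W`.
  rw [abs_le] at hsum ⊢
  constructor <;> nlinarith [hsum.1, hsum.2]

/-- An orbit segment no longer than any tower meets at most one top, since a whole tower lies
between two tops. That top contributes at most `W`, and the boundary terms another `W`. -/
theorem orbitVisits_le {n : ℕ} {L : Finset (ℤ × Fin k)} (hL : L ⊆ D.F n) {W : ℝ} (hW0 : 0 ≤ W)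
    (hW : ∀ j, (count L j : ℝ) ≤ W) {h : ℕ} (hh : ∀ j, h ≤ D.height n j) {x : D.Space}
    (hx : x ∈ D.domain) : D.orbitVisits (D.cyl n {f | f ∈ L}) h x ≤ 2 * W := by
  have hne : ∀ y, D.top n L y ≠ 0 → ∃ f, y ∈ D.cyl n {f} ∧ f.1 + 1 = D.height n f.2 := by
    intro y hy
    by_cases h1 : ∃ f, y ∈ D.cyl n {f}
    · obtain ⟨f, hf⟩ := h1
      refine ⟨f, hf, ?_⟩
      by_contra h2
      rw [top, lift_of_mem _ hf, if_neg h2] at hy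
      exact hy rfl
    · exact absurd (lift_of_notMem _ h1) hy
  have hle : ∀ y, D.top n L y ≤ W := by
    refine lift_induction (P := fun r => r ≤ W) hW0 fun f => ?_
    split_ifs
    · exact hW _
    · exact hW0
  have huniq : ∀ i j : ℕ, i < j → j < h → D.top n L (D.act i x) ≠ 0 →
      D.top n L (D.act j x) ≠ 0 → False := by
    intro i j hij hj hi0 hj0
    obtain ⟨f, hf, hft⟩ := hne _ hi0
    obtain ⟨f', hf', hft'⟩ := hne _ hj0
    have hjh := hh f'.2
    have e : D.act j x = D.act (j - i : ℤ) (D.act i x) := by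
      rw [act_act hx, sub_add_cancel]
    rw [e] at hf'
    have := act_neg_mem_cyl (act_mem_domain hx _) hf' (by omega) (by omega)
    have h1 := eq_of_mem_cyl hf this
    rw [h1] at hft
    simp only at hft
    omega
  have hsum : D.topSum n L h x ≤ W := by
    by_cases hex : ∃ j ∈ Finset.range h, D.top n L (D.act j x) ≠ 0
    · obtain ⟨j, hj, hj0⟩ := hex
      unfold topSum
      rw [Finset.sum_eq_single_of_mem j hj]
      · exact hle _
      · intro i hi hij
        by_contra hi0
        rw [Finset.mem_range] at hi hj
        rcases lt_or_gt_of_ne hij with hlt | hlt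
        · exact huniq i j hlt hj hi0 hj0
        · exact huniq j i hlt hi hj0 hi0
    · push Not at hex
      unfold topSum
      rw [Finset.sum_eq_zero hex]
      exact hW0
  rw [orbitVisits_eq hL hx]
  have b3 := below_nonneg n L x
  have b8 := below_le (n := n) hW hW0 (D.act h x)
  linarith

/-- The orbit of a point visits all levels of the tower that contains the point, in the past or in
the future. -/
theorem count_le_orbitVisits_add {n : ℕ} {L : Finset (ℤ × Fin k)} (hL : L ⊆ D.F n) {x : D.Space}
    (hx : x ∈ D.domain) {f : ℤ × Fin k} (hf : x ∈ D.cyl n {f}) {h : ℕ}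
    (hh : D.height n f.2 = h) :
    (count L f.2 : ℝ) ≤ D.orbitVisits (D.cyl n {f | f ∈ L}) h x +
      ∑ j ∈ Finset.range h, (D.cyl n {f | f ∈ L}).indicator (1 : D.Space → ℝ) (D.act (-j) x) := by
  have hF := mem_F_iff.1 (mem_F_of_mem_cyl hf)
  obtain ⟨a, ha⟩ := Int.eq_ofNat_of_zero_le hF.1
  have hx_below : D.below n L x = countBelow L f := lift_of_mem _ hf
  have h1 : (count L f.2 : ℝ) - countBelow L f ≤ D.orbitVisits (D.cyl n {f | f ∈ L}) h x := by
    rw [orbitVisits_eq hL hx, hx_below]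
    have b := below_nonneg n L (D.act h x)
    have ht : (count L f.2 : ℝ) ≤ D.topSum n L h x := by
      -- From level `a` the orbit reaches the top of its tower at time `h - 1 - a`.
      have hlt : h - 1 - a < h := by omega
      have hmem := act_mem_cyl hx hf (g := ((h - 1 - a : ℕ) : ℤ)) (mem_F_iff.2 ⟨by
        change 0 ≤ ((h - 1 - a : ℕ) : ℤ) + f.1
        omega, by
        change ((h - 1 - a : ℕ) : ℤ) + f.1 < D.height n f.2
        omega⟩)
      have : D.top n L (D.act ((h - 1 - a : ℕ) : ℤ) x) = count L f.2 := by
        rw [top, lift_of_mem _ hmem, if_pos]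
        change ((h - 1 - a : ℕ) : ℤ) + f.1 + 1 = D.height n f.2
        omega
      rw [← this]
      exact Finset.single_le_sum (f := fun j : ℕ => D.top n L (D.act j x))
        (fun _ _ => top_nonneg _ _ _) (Finset.mem_range.2 hlt)
    linarith
  have h2 : (countBelow L f : ℝ) ≤ ∑ j ∈ Finset.range h,
      (D.cyl n {f | f ∈ L}).indicator (1 : D.Space → ℝ) (D.act (-j) x) := by
    have hpos : ∀ y, 0 ≤ (D.cyl n {f | f ∈ L}).indicator (1 : D.Space → ℝ) y := fun y =>
      Set.indicator_nonneg (fun _ _ => zero_le_one) y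
    set y := D.act (-a) x with hy
    have hyd : y ∈ D.domain := act_mem_domain hx _
    have hyc : y ∈ D.cyl n {(0, f.2)} := by
      have := act_mem_cyl hx hf (g := -a) (by rw [ha]; simpa using D.zero_mem_F n f.2)
      rwa [ha, neg_add_cancel] at this
    have hya : D.act a y = x := by rw [hy, act_act hx, add_neg_cancel, act_zero]
    have hv := orbitVisits_eq hL hyd a
    rw [hya, hx_below, below, lift_of_mem _ hyc, countBelow_eq_zero (f := (0, f.2)) hL le_rfl] at hv
    have ht := topSum_nonneg n L a y
    calc (countBelow L f : ℝ) ≤ D.orbitVisits (D.cyl n {f | f ∈ L}) a y := by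
          rw [hv]
          push_cast
          linarith
      -- The point `x` itself, at time `a`, is included so that the reversed sum starts at `j = 0`;
      -- still `a + 1 ≤ h`.
      _ ≤ D.orbitVisits (D.cyl n {f | f ∈ L}) (a + 1) y :=
          Finset.sum_le_sum_of_subset_of_nonneg (Finset.range_mono (Nat.le_succ a))
            fun _ _ _ => hpos _
      _ = ∑ j ∈ Finset.range (a + 1),
          (D.cyl n {f | f ∈ L}).indicator (1 : D.Space → ℝ) (D.act (-j) x) := by
        unfold orbitVisits
        rw [← Finset.sum_range_reflect]
        refine Finset.sum_congr rfl fun j hj => ?_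
        rw [hy, act_act hx]
        congr 2
        have := Finset.mem_range.1 hj
        omega
      _ ≤ _ := Finset.sum_le_sum_of_subset_of_nonneg (Finset.range_mono (by omega))
            fun _ _ _ => hpos _
  linarith

end CFData

/-! ### Uniform distribution of visits within `X_0`. -/

namespace CFData

variable {k : ℕ} {D : CFData k} {lam : ℕ → Fin k → ℝ≥0} {μ : Measure D.Space}

theorem measurableSet_base : MeasurableSet D.base :=
  (isOpen_cyl (D := D) (n := 0) subset_rfl).measurableSet

theorem exists_cylinder_inter_base {s : Set D.Space} (hs : s ∈ D.cylinders) :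
    ∃ (n : ℕ) (A : Finset (ℤ × Fin k)), A ⊆ D.baseLevels n ∧ s ∩ D.base = D.cyl n {f | f ∈ A} := by
  obtain ⟨n, A, -, rfl⟩ := hs
  refine ⟨n, A ∩ D.baseLevels n, Finset.inter_subset_right, ?_⟩
  rw [← cyl_baseLevels n, cyl_inter]
  congr 1
  ext f
  simp

namespace IsBalanced

theorem exists_orbitVisits_le (H : D.IsBalanced lam μ) : ∃ K > 0, ∀ᶠ l in atTop,
    ∀ x ∈ D.domain, D.orbitVisits D.base (D.minHeight l) x ≤ K / width lam l := by
  obtain ⟨c, hc, C, hC, hev⟩ := H.exists_count_bounds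
  refine ⟨2 * C, by positivity, ?_⟩
  filter_upwards [hev] with l ⟨hpos, hl⟩ x hx
  rw [mul_div_assoc, ← cyl_baseLevels l]
  exact orbitVisits_le (baseLevels_subset l) (by positivity)
    (fun j => (le_div_iff₀ hpos).2 (hl j).2.1) (D.minHeight_le l) hx

/-- In the castle `l` the boundary error would be as large as the number of visits. The comparison
is made in the castle `l - p` for a fixed `p`, where towers have fewer levels in `X_0` by a factor
of order `2 ^ p`. -/
theorem eventually_abs_orbitVisits_sub_le (H : D.IsBalanced lam μ) {s : Set D.Space}
    (hs : s ∈ D.cylinders) {ε : ℝ} (hε : 0 < ε) : ∀ᶠ l in atTop, ∀ x ∈ D.domain,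
      |D.orbitVisits (s ∩ D.base) (D.minHeight l) x -
        μ.real (s ∩ D.base) * D.orbitVisits D.base (D.minHeight l) x| ≤ ε / width lam l := by
  obtain ⟨n, A, hA, hsA⟩ := exists_cylinder_inter_base hs
  have hAF := hA.trans (baseLevels_subset n)
  obtain ⟨K, hK, hevK⟩ := H.exists_orbitVisits_le
  obtain ⟨c, hc, C, hC, hev⟩ := H.exists_count_bounds
  obtain ⟨c', hc', hpow⟩ := H.exists_pow_mul_width_le
  -- With `2 + η ≤ 3`, this `p` brings the boundary error below half of `ε / width lam l`; the bound
  -- `ε / (2 * K)` on `η` handles the other half.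
  obtain ⟨p, hp⟩ := pow_unbounded_of_one_lt (6 * C / (c' * ε)) (one_lt_two (α := ℝ))
  set η := min 1 (ε / (2 * K)) with hη
  have hη0 : 0 < η := lt_min one_pos (by positivity)
  have hβ1 : μ.real (s ∩ D.base) ≤ 1 := by
    refine ENNReal.toReal_le_of_le_ofReal zero_le_one ?_
    rw [ENNReal.ofReal_one, ← H.measure_base]
    exact measure_mono Set.inter_subset_right
  have hevm := ((H.eventually_abs_count_sub_le hAF hη0).and
    ((hev.and hpow).and (eventually_ge_atTop n)))
  filter_upwards [(tendsto_sub_atTop_nat p).eventually hevm, hev, hevK, eventually_ge_atTop p]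
    with l ⟨h1, ⟨⟨hposm, h2⟩, h3⟩, h4⟩ ⟨hposl, _⟩ h5 hpl x hx
  have hW := abs_orbitVisits_sub_le (baseLevels_subset (l - p))
    (levels_subset_levels (Nat.zero_le n) h4 hA) (β := μ.real (s ∩ D.base)) (ε := η)
    (W := C / width lam (l - p)) measureReal_nonneg hβ1 hη0.le (by positivity)
    (fun j => (le_div_iff₀ hposm).2 (h2 j).2.1) (by rw [hsA]; exact h1) hx (D.minHeight l)
  rw [cyl_levels h4 hAF, cyl_baseLevels, ← hsA] at hW
  refine hW.trans ?_
  have h3' := h3 p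
  rw [Nat.sub_add_cancel hpl] at h3'
  have e1 : η * D.orbitVisits D.base (D.minHeight l) x ≤ ε / 2 / width lam l := by
    calc η * D.orbitVisits D.base (D.minHeight l) x ≤ η * (K / width lam l) := by
          gcongr
          exact h5 x hx
      _ ≤ ε / (2 * K) * (K / width lam l) := by
          gcongr
          exact min_le_right _ _
      _ = ε / 2 / width lam l := by field_simp
  have e2 : (2 + η) * (C / width lam (l - p)) ≤ ε / 2 / width lam l := by
    have hη1 : η ≤ 1 := min_le_left _ _
    calc (2 + η) * (C / width lam (l - p)) ≤ 3 * (C / (2 ^ p * (c' * width lam l))) := by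
          gcongr
          linarith
      _ ≤ ε / 2 / width lam l := by
          rw [div_lt_iff₀ (by positivity)] at hp
          rw [← mul_div_assoc, div_div, div_le_div_iff₀ (by positivity) (by positivity)]
          nlinarith
  calc _ ≤ ε / 2 / width lam l + ε / 2 / width lam l := add_le_add e1 e2
    _ = ε / width lam l := by ring

end IsBalanced

end CFData

open CFData

/-! ### Balanced models -/

section Model

variable {Ω : Type*} [MeasurableSpace Ω] {m : Measure Ω} {T : Ω ≃ᵐ Ω} {k : ℕ} {D : CFData k}
  {lam : ℕ → Fin k → ℝ≥0} {μ : Measure D.Space} {φ : Ω → D.Space} {c : ℝ≥0}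

theorem ae_intertwine (hT : MeasurePreserving T m m) (hdom : μ D.domainᶜ = 0)
    (hφ : MeasurePreserving φ m (c • μ)) (hint : ∀ᵐ x ∂m, φ (T x) = D.act 1 (φ x)) :
    ∀ᵐ x ∂m, φ x ∈ D.domain ∧ ∀ j : ℕ, φ (T^[j] x) = D.act j (φ x) ∧
      φ (T.symm^[j] x) = D.act (-j) (φ x) := by
  have h1 : ∀ᵐ x ∂m, φ x ∈ D.domain := by
    refine hφ.quasiMeasurePreserving.ae (p := fun y => y ∈ D.domain) ?_
    rw [ae_iff]
    change (c • μ) D.domainᶜ = 0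
    rw [Measure.smul_apply, hdom, smul_zero]
  have h2 : ∀ᵐ x ∂m, ∀ j : ℕ, φ (T^[j] x) = D.act j (φ x) := by
    have : ∀ᵐ x ∂m, ∀ j : ℕ, φ (T (T^[j] x)) = D.act 1 (φ (T^[j] x)) := ae_all_iff.2 fun j =>
      (hT.iterate j).quasiMeasurePreserving.ae hint
    filter_upwards [this, h1] with x hx hxd j
    induction j with
    | zero => rw [Nat.cast_zero, act_zero]; rfl
    | succ j ih =>
      rw [Function.iterate_succ_apply', hx, ih, act_act hxd, add_comm, Nat.cast_succ]
  have h3 : ∀ᵐ x ∂m, ∀ j : ℕ, φ (T.symm^[j] x) ∈ D.domain ∧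
      φ (T^[j] (T.symm^[j] x)) = D.act j (φ (T.symm^[j] x)) := ae_all_iff.2 fun j =>
    (hT.symm.iterate j).quasiMeasurePreserving.ae (p := fun x => φ x ∈ D.domain ∧
      φ (T^[j] x) = D.act j (φ x)) (by filter_upwards [h1, h2] with x hx hx' using ⟨hx, hx' j⟩)
  filter_upwards [h1, h2, h3] with x hx1 hx2 hx3
  refine ⟨hx1, fun j => ⟨hx2 j, ?_⟩⟩
  obtain ⟨h4, h5⟩ := hx3 j
  rw [(Function.LeftInverse.iterate T.apply_symm_apply j) x] at h5
  rw [h5, act_act h4, neg_add_cancel, act_zero]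

theorem visits_preimage {x : Ω} (hx : ∀ j : ℕ, φ (T^[j] x) = D.act j (φ x) ∧
    φ (T.symm^[j] x) = D.act (-j) (φ x)) (B : Set D.Space) (h : ℕ) :
    visits T (φ ⁻¹' B) h x = D.orbitVisits B h (φ x) :=
  Finset.sum_congr rfl fun j _ => by
    rw [← (hx j).1]
    rfl

theorem visits_symm_preimage {x : Ω} (hx : ∀ j : ℕ, φ (T^[j] x) = D.act j (φ x) ∧
    φ (T.symm^[j] x) = D.act (-j) (φ x)) (B : Set D.Space) (h : ℕ) :
    visits T.symm (φ ⁻¹' B) h x =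
      ∑ j ∈ Finset.range h, B.indicator (1 : D.Space → ℝ) (D.act (-j) (φ x)) :=
  Finset.sum_congr rfl fun j _ => by
    rw [← (hx j).2]
    rfl

theorem measure_preimage_eq (hφ : MeasurePreserving φ m (c • μ)) {s : Set D.Space}
    (hs : MeasurableSet s) : m (φ ⁻¹' s) = c * μ s := by
  rw [hφ.measure_preimage hs.nullMeasurableSet]
  rfl

theorem measureReal_preimage_eq (hφ : MeasurePreserving φ m (c • μ)) {s : Set D.Space}
    (hs : MeasurableSet s) : m.real (φ ⁻¹' s) = c * μ.real s := by
  rw [measureReal_def, measure_preimage_eq hφ hs, ENNReal.toReal_mul]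
  rfl

/-- The two-sided saturation of `Y` is invariant and not null. -/
theorem ae_exists_iterate_mem (hT : Ergodic T m) {Y : Set Ω} (hY : MeasurableSet Y)
    (hY0 : m Y ≠ 0) : ∀ᵐ x ∂m, ∃ n : ℕ, T^[n] x ∈ Y ∨ T.symm^[n] x ∈ Y := by
  set E : Set Ω := {x | ∃ n : ℕ, T^[n] x ∈ Y ∨ T.symm^[n] x ∈ Y} with hE
  have hEm : MeasurableSet E := by
    have : E = ⋃ n : ℕ, (T^[n] ⁻¹' Y ∪ T.symm^[n] ⁻¹' Y) := by
      ext x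
      simp [hE]
    rw [this]
    exact MeasurableSet.iUnion fun n => ((T.measurable.iterate n) hY).union
      ((T.symm.measurable.iterate n) hY)
  have hinv : T ⁻¹' E = E := by
    ext x
    constructor
    · rintro ⟨n, h | h⟩
      · exact ⟨n + 1, Or.inl h⟩
      · cases n with
        | zero => exact ⟨1, Or.inl h⟩
        | succ n =>
          refine ⟨n, Or.inr ?_⟩
          rwa [Function.iterate_succ_apply, T.symm_apply_apply] at h
    · rintro ⟨n, h | h⟩
      · cases n with
        | zero =>
          refine ⟨1, Or.inr ?_⟩
          change T.symm (T x) ∈ Y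
          rwa [T.symm_apply_apply]
        | succ n => exact ⟨n, Or.inl h⟩
      · refine ⟨n + 1, Or.inr ?_⟩
        rwa [Function.iterate_succ_apply, T.symm_apply_apply]
  rcases hT.toPreErgodic.ae_empty_or_univ hEm hinv with h | h
  · exact absurd (measure_mono_null (show Y ⊆ E from fun x hx => ⟨0, Or.inl hx⟩)
      (ae_eq_empty.1 h)) hY0
  · exact eventuallyEq_univ.1 h

/-- For a point in a tower of least height `h`, forward and backward visits up to time `h` together
cover every level of that tower in `X_0`, of order `1 / width` many. The part `Z` of `Y` in that
tower has measure bounded below. Integrating, with equal forward and backward sums by `corr_symm`,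
gives the bound and the factor `1 / 2`. -/
theorem exists_le_corr (H : D.IsBalanced lam μ) (hT : MeasurePreserving T m m) (hc : c ≠ 0)
    (hφ : MeasurePreserving φ m (c • μ)) (hint : ∀ᵐ x ∂m, φ (T x) = D.act 1 (φ x)) :
    ∃ κ > 0, ∀ᶠ l in atTop, 0 < width lam l ∧
      κ / width lam l ≤ corr m T (φ ⁻¹' D.base) (φ ⁻¹' D.base) (D.minHeight l) := by
  have := H.nonempty_fin
  have hcpos : (0 : ℝ) < c := by exact_mod_cast pos_of_ne_zero hc
  obtain ⟨d, hd, C, hC, hev⟩ := H.exists_count_bounds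
  set Y := φ ⁻¹' D.base with hYdef
  have hY : MeasurableSet Y := hφ.measurable measurableSet_base
  have hYfin : m Y ≠ ∞ := by
    rw [measure_preimage_eq hφ measurableSet_base, H.measure_base, mul_one]
    exact ENNReal.coe_ne_top
  have hfm : IsFiniteMeasure (m.restrict Y) := ⟨by simpa using hYfin.lt_top⟩
  refine ⟨c * d ^ 2 / 2, by positivity, ?_⟩
  filter_upwards [hev] with l ⟨hpos, hl⟩
  refine ⟨hpos, ?_⟩
  obtain ⟨j, hj⟩ := D.exists_minHeight_eq l
  set h := D.minHeight l
  set w : ℝ := (count (D.baseLevels l) j : ℝ) with hw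
  set Z := φ ⁻¹' (D.base ∩ D.cyl l {f | f ∈ (D.F l).filter fun f => f.2 = j}) with hZ
  have hZm' : MeasurableSet (D.base ∩ D.cyl l {f | f ∈ (D.F l).filter fun f => f.2 = j}) :=
    measurableSet_base.inter (isOpen_cyl (Finset.filter_subset _ _)).measurableSet
  have hZm : MeasurableSet Z := hφ.measurable hZm'
  have hZY : Z ⊆ Y := Set.preimage_mono Set.inter_subset_left
  have hZr : m.real Z = c * (w * lam l j) := by
    rw [hZ, measureReal_preimage_eq hφ hZm', hw, ← H.measureReal_base_inter]
    simp only [Finset.mem_filter]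
  have hvi : ∀ R : Ω ≃ᵐ Ω, IntegrableOn (visits R Y h) Y m := by
    intro R
    refine integrable_finsetSum _ fun j _ => ?_
    exact (integrable_const (1 : ℝ)).indicator ((R.measurable.iterate j) hY)
  have key : w * m.real Z ≤ ∫ x in Y, (visits T Y h x + visits T.symm Y h x) ∂m := by
    calc w * m.real Z = ∫ x in Y, Z.indicator (fun _ => w) x ∂m := by
          rw [integral_indicator_const _ hZm, measureReal_restrict_apply hZm,
            Set.inter_eq_left.2 hZY, smul_eq_mul, mul_comm]
      _ ≤ _ := by
          refine integral_mono_ae ((integrable_const w).indicator hZm)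
            ((hvi T).add (hvi T.symm)) (ae_restrict_of_ae ?_)
          filter_upwards [ae_intertwine hT H.null_compl_domain hφ hint] with x ⟨hx, hxj⟩
          by_cases hxZ : x ∈ Z
          · rw [Set.indicator_of_mem hxZ, hYdef, visits_preimage hxj, visits_symm_preimage hxj]
            obtain ⟨-, hxZ2⟩ := hxZ
            obtain ⟨f, hf, hxf⟩ := mem_cyl_iff.1 hxZ2
            obtain rfl : f.2 = j := (Finset.mem_filter.1 hf).2
            have := count_le_orbitVisits_add (baseLevels_subset l) hx hxf hj
            rwa [cyl_baseLevels] at this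
          · rw [Set.indicator_of_notMem hxZ]
            exact add_nonneg (visits_nonneg _ _ _ _) (visits_nonneg _ _ _ _)
  rw [integral_add (hvi T) (hvi T.symm), setIntegral_visits T.measurable hY _ hYfin,
    setIntegral_visits T.symm.measurable hY _ hYfin, ← corr_symm hT hY hY, hZr] at key
  have h1 : d / width lam l ≤ w := by
    rw [div_le_iff₀ hpos]
    exact (hl j).1
  have h2 : d ≤ w * lam l j := (hl j).2.2
  have h3 : d / width lam l * (c * d) ≤ w * (c * (w * lam l j)) := by gcongr
  have h4 : c * d ^ 2 / 2 / width lam l = (d / width lam l * (c * d)) / 2 := by ring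
  rw [h4]
  linarith

/-- Both the bound on visits and the distribution error are of order `1 / width`, and
`exists_le_corr` turns that order into `b l`. -/
theorem uniformlyVisited_preimage_base (H : D.IsBalanced lam μ) (hT : Ergodic T m) (hc : c ≠ 0)
    (hφ : MeasurePreserving φ m (c • μ)) (hint : ∀ᵐ x ∂m, φ (T x) = D.act 1 (φ x))
    {ψ : D.Space → Ω} (hψ : Measurable ψ) (hψφ : ∀ᵐ x ∂m, ψ (φ x) = x) :
    UniformlyVisited m T (φ ⁻¹' D.base) D.minHeight
      (fun l => corr m T (φ ⁻¹' D.base) (φ ⁻¹' D.base) (D.minHeight l)) := by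
  have hmp := hT.toMeasurePreserving
  have hcpos : (0 : ℝ) < c := by exact_mod_cast pos_of_ne_zero hc
  have hY : MeasurableSet (φ ⁻¹' D.base) := hφ.measurable measurableSet_base
  have hYm : m (φ ⁻¹' D.base) = c := by
    rw [measure_preimage_eq hφ measurableSet_base, H.measure_base, mul_one]
  obtain ⟨κ, hκ, hev⟩ := exists_le_corr H hmp hc hφ hint
  obtain ⟨K, hK, hevK⟩ := H.exists_orbitVisits_le
  have hint' := ae_intertwine hmp H.null_compl_domain hφ hint
  refine ⟨hmp, hY, ?_, ?_, ?_, fun _ => rfl, ⟨K / κ, ?_⟩, ?_, ?_⟩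
  · rw [hYm]
    exact_mod_cast hc
  · rw [hYm]
    exact ENNReal.coe_ne_top
  · refine tendsto_atTop_mono' _ ?_ (H.tendsto_width_inv.const_mul_atTop hκ)
    filter_upwards [hev] with l hl using hl.2
  · filter_upwards [hev, hevK] with l ⟨hpos, hl⟩ hK'
    filter_upwards [hint'] with x ⟨hx, hxj⟩
    rw [visits_preimage hxj]
    calc _ ≤ K / width lam l := hK' _ hx
      _ = K / κ * (κ / width lam l) := by field_simp
      _ ≤ _ := by gcongr
  · refine ae_exists_iterate_mem hT hY ?_
    rw [hYm]
    exact_mod_cast hc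
  · refine ⟨Set.preimage φ '' D.cylinders, ?_, ?_, ?_, ?_⟩
    · exact isPiSystem_cylinders.comap φ
    · rintro _ ⟨s, hs, rfl⟩
      exact hφ.measurable (measurableSet_of_mem_cylinders hs)
    · intro A hA
      -- The left inverse `ψ` makes every measurable set a preimage under `φ` of a Borel set, modulo
      -- a null set.
      refine ⟨φ ⁻¹' (ψ ⁻¹' A), ?_, ?_⟩
      · rw [← MeasurableSpace.comap_generateFrom, ← borel_eq_generateFrom_cylinders]
        exact ⟨_, hψ hA, rfl⟩
      · filter_upwards [hψφ] with x hx
        exact propext (by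
          change x ∈ A ↔ ψ (φ x) ∈ A
          rw [hx])
    · rintro _ ⟨s, hs, rfl⟩ ε hε
      have hsm := (measurableSet_of_mem_cylinders hs).inter measurableSet_base
      have hratio : m.real (φ ⁻¹' s ∩ φ ⁻¹' D.base) / m.real (φ ⁻¹' D.base) =
          μ.real (s ∩ D.base) := by
        rw [← Set.preimage_inter, measureReal_preimage_eq hφ hsm,
          measureReal_preimage_eq hφ measurableSet_base, measureReal_def μ D.base, H.measure_base,
          ENNReal.toReal_one]
        field_simp
      rw [hratio, ← Set.preimage_inter]
      filter_upwards [hev, H.eventually_abs_orbitVisits_sub_le hs (ε := ε * κ) (by positivity)]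
        with l ⟨hpos, hl⟩ hA
      filter_upwards [hint'] with x ⟨hx, hxj⟩
      rw [visits_preimage hxj, visits_preimage hxj]
      calc _ ≤ ε * κ / width lam l := hA _ hx
        _ = ε * (κ / width lam l) := by ring
        _ ≤ _ := by gcongr

theorem quasiMeasurePreserving_of_leftInverse (hc : c ≠ 0) (hφ : MeasurePreserving φ m (c • μ))
    {ψ : D.Space → Ω} (hψ : Measurable ψ) (hψφ : ∀ᵐ x ∂m, ψ (φ x) = x) :
    Measure.QuasiMeasurePreserving ψ μ m := by
  refine ⟨hψ, Measure.AbsolutelyContinuous.mk fun s hs h0 => ?_⟩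
  rw [Measure.map_apply hψ hs]
  have e : (φ ⁻¹' (ψ ⁻¹' s) : Set Ω) =ᵐ[m] s := by
    filter_upwards [hψφ] with x hx
    exact propext (by
      change ψ (φ x) ∈ s ↔ x ∈ s
      rw [hx])
  have h1 := measure_preimage_eq hφ (hψ hs)
  rw [measure_congr e, h0] at h1
  rcases mul_eq_zero.1 h1.symm with h2 | h2
  · exact absurd (ENNReal.coe_eq_zero.1 h2) hc
  · exact h2

/-- The image of `B` under the action agrees almost everywhere with a set pulled back through `ψ`,
which also supplies the measurability needed. -/
theorem measureReal_inter_act_image (hT : MeasurePreserving T m m) (hdom : μ D.domainᶜ = 0)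
    (hc : c ≠ 0) (hφ : MeasurePreserving φ m (c • μ))
    (hint : ∀ᵐ x ∂m, φ (T x) = D.act 1 (φ x))
    {ψ : D.Space → Ω} (hψ : Measurable ψ) (hψφ : ∀ᵐ x ∂m, ψ (φ x) = x)
    (hφψ : ∀ᵐ y ∂μ, φ (ψ y) = y) {A B : Set D.Space} (hA : MeasurableSet A)
    (hB : MeasurableSet B) (j : ℕ) :
    m.real (φ ⁻¹' A ∩ T.symm^[j] ⁻¹' (φ ⁻¹' B)) = c * μ.real (A ∩ D.act j '' B) := by
  set E := T.symm^[j] ⁻¹' (φ ⁻¹' B) with hE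
  have hEm : MeasurableSet E := (T.symm.measurable.iterate j) (hφ.measurable hB)
  have h1 : (D.act j '' B : Set D.Space) =ᵐ[μ] (ψ ⁻¹' E : Set D.Space) := by
    filter_upwards [(quasiMeasurePreserving_of_leftInverse hc hφ hψ hψφ).ae
      (ae_intertwine hT hdom hφ hint), hφψ] with y ⟨hy, hyj⟩ hφy
    rw [hφy] at hy hyj
    refine propext ?_
    change y ∈ D.act j '' B ↔ φ (T.symm^[j] (ψ y)) ∈ B
    rw [(hyj j).2]
    constructor
    · rintro ⟨b, hb, rfl⟩
      -- Off the domain the action is the identity, so a point there cannot be mapped into the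
      -- domain.
      have hbd : b ∈ D.domain := by
        by_contra hbd
        have : D.act j b = b := dif_neg hbd
        exact hbd (this ▸ hy)
      rwa [act_act hbd, neg_add_cancel, act_zero]
    · intro hyB
      exact ⟨_, hyB, by rw [act_act hy, add_neg_cancel, act_zero]⟩
  have h2 : (φ ⁻¹' A ∩ φ ⁻¹' (ψ ⁻¹' E) : Set Ω) =ᵐ[m] (φ ⁻¹' A ∩ E : Set Ω) := by
    refine (ae_eq_refl _).inter ?_
    filter_upwards [hψφ] with x hx
    exact propext (by
      change ψ (φ x) ∈ E ↔ x ∈ E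
      rw [hx])
  rw [measureReal_congr ((ae_eq_refl A).inter h1), ← measureReal_preimage_eq hφ (hA.inter (hψ hEm)),
    Set.preimage_inter, measureReal_congr h2]

theorem tendsto_of_isBalancedModel (hT : Ergodic T m) (H : IsBalancedModel T m D lam μ) :
    Tendsto D.minHeight atTop atTop ∧
      ∀ A B : Set D.Space, MeasurableSet A → MeasurableSet B → A ⊆ D.base → B ⊆ D.base →
        Tendsto (fun l =>
            (∑ j ∈ Finset.range (D.minHeight l), μ.real (A ∩ D.act j '' B)) /
              ∑ j ∈ Finset.range (D.minHeight l), μ.real (D.base ∩ D.act j '' D.base))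
          atTop (𝓝 (μ.real A * μ.real B)) := by
  obtain ⟨hbal, φ, ψ, c, hc, hφ, hψ, hψφ, hφψ, hint⟩ := H
  refine ⟨hbal.tendsto_minHeight, fun A B hA hB hAb hBb => ?_⟩
  -- The inverse is used because intersections with forward images of `B` are intersections with
  -- preimages under it.
  have hU := (uniformlyVisited_preimage_base hbal hT hc hφ hint hψ hψφ).symm
  have hcpos : (0 : ℝ) < c := by exact_mod_cast pos_of_ne_zero hc
  have hlim := hU.tendsto_corr_of_subset (hφ.measurable hA) (Set.preimage_mono hAb)
    (hφ.measurable hB) (Set.preimage_mono hBb)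
  have hcorr : ∀ A B : Set D.Space, MeasurableSet A → MeasurableSet B → ∀ h,
      corr m T.symm (φ ⁻¹' A) (φ ⁻¹' B) h =
        c * ∑ j ∈ Finset.range h, μ.real (A ∩ D.act j '' B) := by
    intro A B hA hB h
    rw [Finset.mul_sum]
    exact Finset.sum_congr rfl fun j _ => measureReal_inter_act_image hT.toMeasurePreserving
      hbal.null_compl_domain hc hφ hint hψ hψφ hφψ hA hB j
  have hb : μ.real D.base = 1 := hbal.measureReal_base
  have heq := hU.eq_corr
  simp_rw [heq, hcorr _ _ hA hB, hcorr _ _ measurableSet_base measurableSet_base,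
    measureReal_preimage_eq hφ hA, measureReal_preimage_eq hφ hB,
    measureReal_preimage_eq hφ measurableSet_base, hb,
    mul_div_mul_left _ _ hcpos.ne'] at hlim
  convert hlim using 2
  field_simp

end Model

/-! ### Weak rational ergodicity along a subsequence. -/

namespace UniformlyVisited

variable {Ω : Type*} [MeasurableSpace Ω] {m : Measure Ω} {T : Ω ≃ᵐ Ω} {Y : Set Ω} {h : ℕ → ℕ}
  {b : ℕ → ℝ}

theorem isSubseqWeaklyRationallyErgodic (H : UniformlyVisited m T Y h b)
    (hh : Tendsto h atTop atTop) : IsSubseqWeaklyRationallyErgodic T m := by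
  -- The least heights need not increase strictly, hence the subsequence.
  obtain ⟨σ, hσ, hhσ⟩ := strictMono_subseq_of_tendsto_atTop hh
  have hy := H.measureReal_pos
  refine ⟨h ∘ σ, Y, hhσ, H.measurableSet, pos_iff_ne_zero.2 H.measure_ne_zero,
    H.measure_ne_top.lt_top, fun A B hA hB hAY hBY => ?_⟩
  have hlim := ((H.symm.tendsto_corr_of_subset hA hAY hB hBY).const_mul (m.real Y ^ 2)).comp
    hσ.tendsto_atTop
  have himg : ∀ (j : ℕ) (B : Set Ω), T^[j] '' B = T.symm^[j] ⁻¹' B := fun j B =>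
    congrFun (Set.image_eq_preimage_of_inverse
      (Function.LeftInverse.iterate T.symm_apply_apply j)
      (Function.LeftInverse.iterate T.apply_symm_apply j)) B
  simp_rw [himg, ← Finset.sum_div]
  convert hlim using 2
  · simp only [Function.comp_apply, H.symm.eq_corr, corr]
    rw [div_div_eq_mul_div]
    ring
  · field_simp

end UniformlyVisited

theorem theorem5p5 {Ω : Type*} [MeasurableSpace Ω] [StandardBorelSpace Ω]
    (m : Measure Ω) [SigmaFinite m] (hinf : m Set.univ = ∞)
    (T : Ω ≃ᵐ Ω) (hT : Ergodic T m) (hbal : IsBalancedFiniteRank T m) :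
    (∀ (k : ℕ) (D : CFData k) (lam : ℕ → Fin k → ℝ≥0) (μ : Measure D.Space),
      IsBalancedModel T m D lam μ →
        Tendsto D.minHeight atTop atTop ∧
        ∀ A B : Set D.Space, MeasurableSet A → MeasurableSet B → A ⊆ D.base → B ⊆ D.base →
          Tendsto (fun l =>
              (∑ j ∈ Finset.range (D.minHeight l), μ.real (A ∩ D.act j '' B)) /
                ∑ j ∈ Finset.range (D.minHeight l), μ.real (D.base ∩ D.act j '' D.base))
            atTop (𝓝 (μ.real A * μ.real B))) ∧
    IsSubseqWeaklyRationallyErgodic T m ∧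
    IsNonSquashable T m := by
  refine ⟨fun k D lam μ H => tendsto_of_isBalancedModel hT H, ?_⟩
  obtain ⟨k, D, lam, μ, hbal, φ, ψ, c, hc, hφ, hψ, hψφ, -, hint⟩ := hbal
  have hU := uniformlyVisited_preimage_base hbal hT hc hφ hint hψ hψφ
  exact ⟨hU.isSubseqWeaklyRationallyErgodic hbal.tendsto_minHeight, hU.isNonSquashable⟩
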